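/- For a compact set $K\subset\mathbb{C}$ with more than one point, let $d>0$ be its diameter and let $w\ge 0$ be its minimal width, i.e. the smallest distance between two parallel lines between which $K$ lies. For $n\ge 1$ let $\Pi_n(K)$ be the set of complex polynomials of exact degree $n$ all of whose zeros lie in $K$, and let $$M_n(K)=\inf_{P\in\Pi_n(K)}\frac{\|P'\|_K}{\|P\|_K},\qquad \|f\|_K=\max_{z\in K}|f(z)|,$$ be the inverse Markov factor of $K$. There are absolute constants $c_1,c_2>0$, where one may take $c_2=28$, such that for every convex compact set $K\subset\mathbb{C}$ with more than one point and every integer $n\ge 1$, $$c_1\max\Big\{\frac{wn}{d^2},\frac{\sqrt n}{d}\Big\}\le M_n(K)\le c_2\max\Big\{\frac{wn}{d^2},\frac{\sqrt n}{d}\Big\}.$$ Moreover, the upper bound, with the same $c_2$ (in particular with $c_2=28$), holds for every connected compact set $K\subset\mathbb{C}$ with more than one point and every integer $n\ge 1$. -/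

import Mathlib

/-- The minimal width of a set `K` in the plane: the infimum of the distances `δ` between two
parallel lines such that `K` lies in the closed strip between them. The lines are
`{z | ⟪u, z⟫ = a}` and `{z | ⟪u, z⟫ = a + δ}` with a unit normal vector `u`, where
`⟪u, z⟫ = Re (conj u * z)` is the real inner product of the plane. -/
noncomputable def minWidth (K : Set ℂ) : ℝ :=
  sInf {δ : ℝ | 0 ≤ δ ∧ ∃ u : ℂ, ‖u‖ = 1 ∧ ∃ a : ℝ, ∀ z ∈ K,
    a ≤ inner ℝ u z ∧ inner ℝ u z ≤ a + δ}

/-- The supremum norm of a complex polynomial over `K`. -/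
noncomputable def supNormOn (K : Set ℂ) (P : Polynomial ℂ) : ℝ :=
  ⨆ z : K, ‖P.eval (z : ℂ)‖

/-- The class of complex polynomials of exact degree `n` with all zeros in `K`. -/
def polysWithZerosIn (n : ℕ) (K : Set ℂ) : Set (Polynomial ℂ) :=
  {P | P.degree = n ∧ ∀ z : ℂ, P.IsRoot z → z ∈ K}

/-- The inverse Markov factor: the infimum of `‖P'‖_K / ‖P‖_K` over all polynomials `P` of exact
degree `n` with all zeros in `K`. -/
noncomputable def inverseMarkovFactor (n : ℕ) (K : Set ℂ) : ℝ :=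
  sInf ((fun P : Polynomial ℂ => supNormOn K (Polynomial.derivative P) / supNormOn K P) ''
    polysWithZerosIn n K)

/-!
**Lower bound.** Let `P` have all its `n` zeros in the convex set `K`, and let `|P|` attain its
maximum over `K` at `ζ`. By the maximum principle `ζ` is a boundary point, so `K` has a support line
there. Choose coordinates with `ζ = 0`, with `K` in the upper half-plane, and with diameter `1`, and
let `z_j` be the zeros. Then `∏ |1 - v / z_j| ≤ 1` on `K`, and if `‖P'‖ = m ‖P‖` then
`|∑ 1 / z_j| ≤ m`. In particular the total inclination `∑ Im z_j / |z_j|²` is at most `m`.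

* Order `√n` (`card_le_sq`). No zero is closer to `0` than `1 / m`, because `|P|` decreases at most
  at the rate `m`. The logarithmic derivative is `O(m)` at `0` and at a point `v` of `K` with
  `|v| = 1 / (4 m)`, so `∑ 1 / z_j² (1 - v / z_j) = O(m²)`. The real part of each summand is at least
  `2/3` up to a multiple of `m Im z_j / |z_j|²`; summation gives `n = O(m²)`.

* Order `w n` (`width_mul_card_le`). Let `K` extend in nearly horizontal directions (slope at most
  `w / 4`) by `s` to the left and by at least as much to the right. By convexity it then contains the
  vertical segment of length `w s / 2` above `0` (`vertical_mem`). Going up along it, a zero at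
  distance at most `2 s` multiplies `|P|²` by a factor `exp (c w²)`, up to a loss in the exponent
  that is bounded by its inclination; maximality at `0` thus leaves only `O(s m / w)` such zeros
  (`card_near_le`). Going left by `s`, every other zero yields a factor `exp (s / 8)`, again up to
  its inclination. Since there are few near zeros, which lose at most a constant each, maximality
  gives `n s = O(s m / w)` (`width_mul_card_le_of_left`). If `s = 0`, all zeros lie in a sector in
  which their reciprocals cannot cancel (`width_mul_card_le_of_sector`).

A near zero may lie on the segment itself and annihilate the product at one of its points. This is
handled by Chebyshev's theorem on monic polynomials of least deviation, applied to all critical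
zeros at once (`sum_exponents_nonpos`).

**Upper bound.** For wide `K` or small `n` the polynomial `(X - x) ^ n` with `x` an end point of a
diameter suffices. Otherwise put half of the zeros at each end point of a diameter, say at `±1`. By
connectedness `K` meets the perpendicular bisector, where the polynomial is at least `1`. As `K` is
thin, its points satisfy either `|ξ| = O(w)`, where the logarithmic derivative is `O(w n)`, or
`|ξ² - 1| ≤ exp (-c |ξ|²)`, where the derivative is `O(√n)` (`endpoint_polynomial_estimate`).
-/

/-! ### Products of linear factors along a segment -/

/-- Chebyshev's bound for the interval `[1/2, 1]`: a product of `k` linear factors is somewhere at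
least `8 ^ (-k)`. -/
lemma exists_prod_abs_sub_ge {ι : Type*} (s : Finset ι) (a : ι → ℝ) :
    ∃ t ∈ Set.Icc (1 / 2 : ℝ) 1, (1 / 8 : ℝ) ^ s.card ≤ ∏ j ∈ s, |t - a j| := by
  by_contra! hcon
  rcases s.eq_empty_or_nonempty with rfl | hs
  · have := hcon 1 (by norm_num)
    simp at this
  -- The substitution `t = (x + 3) / 4` maps `[-1, 1]` onto `[1/2, 1]`.
  set P : Polynomial ℝ := ∏ j ∈ s, (Polynomial.C 2 * Polynomial.X + Polynomial.C (6 - 8 * a j))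
    with hP
  have hlin : ∀ c : ℝ, (Polynomial.C 2 * Polynomial.X + Polynomial.C c).leadingCoeff = 2 :=
    fun c => Polynomial.leadingCoeff_linear (by norm_num)
  have hdeg1 : ∀ c : ℝ, (Polynomial.C 2 * Polynomial.X + Polynomial.C c).degree = 1 :=
    fun c => Polynomial.degree_linear (by norm_num)
  have hlead : P.leadingCoeff = 2 ^ s.card := by
    rw [hP, Polynomial.leadingCoeff_prod]
    simp only [hlin, Finset.prod_const]
  have hdeg : P.degree = s.card := by
    rw [hP, Polynomial.degree_prod]
    simp only [hdeg1]
    simp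
  have hbd : ∀ x ∈ Set.Icc (-1 : ℝ) 1, |P.eval x| ≤ 1 := by
    intro x hx
    have h1 := hcon ((x + 3) / 4) ⟨by linarith [hx.1], by linarith [hx.2]⟩
    have h2 : P.eval x = 8 ^ s.card * ∏ j ∈ s, ((x + 3) / 4 - a j) := by
      rw [hP, Polynomial.eval_prod, ← Finset.prod_const, ← Finset.prod_mul_distrib]
      refine Finset.prod_congr rfl fun j _ => ?_
      simp; ring
    rw [h2, abs_mul, Finset.abs_prod, abs_of_pos (by positivity)]
    calc (8 : ℝ) ^ s.card * ∏ j ∈ s, |(x + 3) / 4 - a j| ≤ 8 ^ s.card * (1 / 8) ^ s.card := by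
          gcongr
      _ = 1 := by rw [← mul_pow]; norm_num
  have h := Polynomial.Chebyshev.leadingCoeff_le_of_forall_abs_le_one hdeg.le hbd
  rw [hlead] at h
  have h3 : (2 : ℝ) ^ (s.card - 1) < 2 ^ s.card :=
    pow_lt_pow_right₀ (by norm_num) (Nat.sub_lt hs.card_pos one_pos)
  linarith

/-- If `∏ |1 - t u_j| ≤ 1` for all `t ∈ [1/2, 1]`, then lower bounds `b_j` for the exponents of the
individual factors sum to at most zero. A factor that may vanish on the segment is still allowed the
exponent of `(|u_j| / 8)²`, because Chebyshev's bound applies to all such factors at once. -/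
lemma sum_exponents_nonpos {ι : Type*} [Fintype ι] (u : ι → ℂ) (b : ι → ℝ)
    (hb : ∀ j, (∀ t ∈ Set.Icc (1 / 2 : ℝ) 1, Real.exp (b j) ≤ ‖1 - t * u j‖ ^ 2) ∨
      Real.exp (b j) ≤ (‖u j‖ / 8) ^ 2)
    (hprod : ∀ t ∈ Set.Icc (1 / 2 : ℝ) 1, ∏ j, ‖1 - t * u j‖ ≤ 1) :
    ∑ j, b j ≤ 0 := by
  classical
  set s : Finset ι := Finset.univ.filter fun j =>
    ¬ ∀ t ∈ Set.Icc (1 / 2 : ℝ) 1, Real.exp (b j) ≤ ‖1 - t * u j‖ ^ 2 with hs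
  obtain ⟨t, ht, hts⟩ := exists_prod_abs_sub_ge s fun j => 1 / ‖u j‖
  have hmid : ∀ j ∈ s, Real.exp (b j) ≤ (‖u j‖ / 8) ^ 2 := by
    intro j hj
    rw [hs, Finset.mem_filter] at hj
    exact (hb j).resolve_left hj.2
  have hpos : ∀ j ∈ s, 0 < ‖u j‖ := by
    intro j hj
    rcases (norm_nonneg (u j)).eq_or_lt with h | h
    · have := hmid j hj
      rw [← h] at this
      have := Real.exp_pos (b j)
      norm_num at *
      linarith
    · exact h
  have h1 : ∏ j ∈ s, Real.exp (b j) ≤ ∏ j ∈ s, ‖1 - t * u j‖ ^ 2 := by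
    calc ∏ j ∈ s, Real.exp (b j) ≤ ∏ j ∈ s, (‖u j‖ / 8) ^ 2 :=
          Finset.prod_le_prod (fun j _ => (Real.exp_pos _).le) hmid
      _ = ((1 / 8) ^ s.card * ∏ j ∈ s, ‖u j‖) ^ 2 := by
          rw [Finset.prod_pow, ← Finset.prod_const, ← Finset.prod_mul_distrib]
          congr 1
          exact Finset.prod_congr rfl fun j _ => by ring
      _ ≤ ((∏ j ∈ s, |t - 1 / ‖u j‖|) * ∏ j ∈ s, ‖u j‖) ^ 2 := by
          have : 0 ≤ ∏ j ∈ s, ‖u j‖ := Finset.prod_nonneg fun j _ => norm_nonneg _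
          gcongr
      _ = ∏ j ∈ s, (|t - 1 / ‖u j‖| * ‖u j‖) ^ 2 := by
          rw [← Finset.prod_mul_distrib, Finset.prod_pow]
      _ ≤ ∏ j ∈ s, ‖1 - t * u j‖ ^ 2 := by
          refine Finset.prod_le_prod (fun j _ => by positivity) fun j hj => ?_
          have hp := hpos j hj
          have h2 : |t - 1 / ‖u j‖| * ‖u j‖ = |1 - t * ‖u j‖| := by
            rw [← abs_of_pos hp, ← abs_mul, abs_of_pos hp, sub_mul, one_div,
              inv_mul_cancel₀ hp.ne', abs_sub_comm]
          rw [h2]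
          have h3 := abs_norm_sub_norm_le (1 : ℂ) (t * u j)
          rw [norm_one, norm_mul, Complex.norm_real, Real.norm_eq_abs,
            abs_of_nonneg (by linarith [ht.1] : (0 : ℝ) ≤ t)] at h3
          gcongr
  have h2 : ∏ j, Real.exp (b j) ≤ ∏ j, ‖1 - t * u j‖ ^ 2 := by
    rw [← Finset.prod_mul_prod_compl s, ← Finset.prod_mul_prod_compl s (fun j => ‖1 - t * u j‖ ^ 2)]
    refine mul_le_mul h1 (Finset.prod_le_prod (fun j _ => (Real.exp_pos _).le) fun j hj => ?_)
      (Finset.prod_nonneg fun j _ => (Real.exp_pos _).le)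
      (Finset.prod_nonneg fun j _ => by positivity)
    rw [hs, Finset.mem_compl, Finset.mem_filter] at hj
    push Not at hj
    exact hj (Finset.mem_univ j) t ht
  rw [← Real.exp_sum, Finset.prod_pow] at h2
  have h3 : (∏ j, ‖1 - t * u j‖) ^ 2 ≤ 1 :=
    pow_le_one₀ (Finset.prod_nonneg fun j _ => norm_nonneg _) (hprod t ht)
  rw [← Real.exp_le_one_iff]
  exact h2.trans h3

/-! ### Exponents of the factors along vertical and along nearly horizontal segments -/

lemma norm_one_sub_mul_div_sq (t : ℝ) (e : ℂ) {z : ℂ} (hz : z ≠ 0) :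
    ‖1 - t * (e / z)‖ ^ 2 =
      1 - 2 * t * ((z.re * e.re + z.im * e.im) / ‖z‖ ^ 2) + (t * (‖e‖ / ‖z‖)) ^ 2 := by
  have hz' : ‖z‖ ≠ 0 := norm_ne_zero_iff.2 hz
  have h1 : 1 - (t : ℂ) * (e / z) = (z - t * e) / z := by field_simp
  have h2 : ‖z - t * e‖ ^ 2 = ‖z‖ ^ 2 - 2 * t * (z.re * e.re + z.im * e.im) + t ^ 2 * ‖e‖ ^ 2 := by
    simp only [← Complex.normSq_eq_norm_sq, Complex.normSq_apply]
    simp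
    ring
  rw [h1, norm_div, div_pow, h2]
  field_simp

/-- Along a vertical segment of height `h`, a zero at distance `r = h / Q` and inclination `S` (the
sine of its angle with the horizontal) contributes a gain `min 1 Q² / 16` minus a loss that is
linear in `Q * S`. Only zeros with `1/4 < Q < 8` and `S > Q / 8` need the second alternative; for
them `Q * S ≥ 1/128`, so that the loss is at least `1000 / 128 > 7`. -/
lemma exp_vertical_le {Q S : ℝ} (hQ : 0 < Q) (hS0 : 0 ≤ S) (hS1 : S ≤ 1) :
    (∀ t ∈ Set.Icc (1 / 2 : ℝ) 1,
      Real.exp (min 1 (Q ^ 2) / 16 - 1000 * (Q * S)) ≤ 1 - 2 * t * (Q * S) + (t * Q) ^ 2) ∨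
    Real.exp (min 1 (Q ^ 2) / 16 - 1000 * (Q * S)) ≤ (Q / 8) ^ 2 := by
  have hQS : 0 ≤ Q * S := by positivity
  have hm1 : min 1 (Q ^ 2) ≤ 1 := min_le_left _ _
  have hm2 : min 1 (Q ^ 2) ≤ Q ^ 2 := min_le_right _ _
  have hm0 : 0 ≤ min 1 (Q ^ 2) := by positivity
  have hexp : Real.exp (min 1 (Q ^ 2) / 16 - 1000 * (Q * S)) ≤ 1 + min 1 (Q ^ 2) / 8 := by
    refine (Real.exp_le_exp.2 (by linarith : _ ≤ min 1 (Q ^ 2) / 16)).trans ?_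
    have h := Real.abs_exp_sub_one_le (x := min 1 (Q ^ 2) / 16)
      (by rw [abs_of_nonneg (by positivity)]; linarith)
    rw [abs_of_nonneg (by positivity : 0 ≤ min 1 (Q ^ 2) / 16)] at h
    linarith [le_abs_self (Real.exp (min 1 (Q ^ 2) / 16) - 1)]
  by_cases h1 : S ≤ Q / 8
  · left
    rintro t ⟨ht1, ht2⟩
    refine hexp.trans ?_
    have h3 : t * (Q * S) ≤ t * (Q * (Q / 8)) := by gcongr
    nlinarith [mul_nonneg (mul_nonneg hQ.le hQ.le) (by linarith : (0 : ℝ) ≤ t - 1 / 2),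
      mul_nonneg (mul_nonneg hQ.le hQ.le)
        (mul_nonneg (by linarith : (0 : ℝ) ≤ t - 1 / 2) (by linarith : (0 : ℝ) ≤ t - 1 / 2))]
  push Not at h1
  by_cases h2 : 8 ≤ Q
  · left
    rintro t ⟨ht1, ht2⟩
    refine hexp.trans ?_
    have h4 : 4 ≤ t * Q := by nlinarith
    have h5 : t * (Q * S) ≤ t * Q := by nlinarith
    nlinarith
  push Not at h2
  by_cases h3 : Q ≤ 1 / 4
  · left
    rintro t ⟨ht1, ht2⟩
    have h4 : t * (Q * S) ≤ Q * S := by nlinarith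
    have h5 : Q * S ≤ 1 / 4 := by nlinarith
    have h6 : Real.exp (min 1 (Q ^ 2) / 16 - 1000 * (Q * S)) ≤ Real.exp (-(4 * (Q * S))) :=
      Real.exp_le_exp.2 (by nlinarith)
    refine h6.trans ?_
    have h7 : Real.exp (-(4 * (Q * S))) ≤ 1 - 2 * (Q * S) := by
      -- `exp (-2 x) ≤ 1 / (1 + 2 x) ≤ 1 - x` for `0 ≤ x ≤ 1/2`
      rw [Real.exp_neg, inv_le_comm₀ (Real.exp_pos _) (by linarith)]
      refine le_trans ?_ (Real.add_one_le_exp _)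
      rw [inv_le_iff_one_le_mul₀ (by linarith)]
      nlinarith
    nlinarith [sq_nonneg (t * Q)]
  · right
    push Not at h3
    have h4 : 1 / 128 ≤ Q * S := by nlinarith
    have h5 : Real.exp (min 1 (Q ^ 2) / 16 - 1000 * (Q * S)) ≤ Real.exp (-7) :=
      Real.exp_le_exp.2 (by linarith)
    have h6 : Real.exp (-7 : ℝ) ≤ 1 / 1024 := by
      rw [Real.exp_neg, ← one_div]
      refine one_div_le_one_div_of_le (by norm_num) ?_
      have h8 : Real.exp 7 = Real.exp 1 ^ 7 := by rw [← Real.exp_nat_mul]; norm_num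
      rw [h8]
      have h9 : (2.7 : ℝ) ≤ Real.exp 1 := by linarith [Real.exp_one_gt_d9]
      calc (1024 : ℝ) ≤ 2.7 ^ 7 := by norm_num
        _ ≤ _ := by gcongr
    nlinarith

lemma exp_neg_le {y : ℝ} (hy0 : 0 ≤ y) (hy1 : y ≤ 1 / 2) :
    Real.exp (-(5 / 2 * y)) ≤ 1 - 5 / 4 * y := by
  rw [Real.exp_neg, inv_le_comm₀ (Real.exp_pos _) (by linarith)]
  refine le_trans ?_ (Real.quadratic_le_exp_of_nonneg (by positivity))
  rw [inv_le_iff_one_le_mul₀ (by linarith)]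
  have h : 0 ≤ 1 / 4 - y ^ 2 := by nlinarith
  nlinarith [mul_nonneg hy0 h]

/-- Let the segment from `0` to `e` run to the left with slope at most `w / 4` and let `z` be a zero
with `2 |Re e| < |z|` which is not both to the left of `e` and below the line of slope `w / 4`.
Then `z` contributes a gain of at least `|Re e| / 8`, minus a loss linear in `Im z / |z|²`. -/
lemma exp_horizontal_le {e z : ℂ} {s w : ℝ} (hs : 0 < s) (hw0 : 0 < w) (hw1 : w ≤ 1)
    (her : e.re = -s) (hei0 : 0 ≤ e.im) (hei : e.im ≤ w / 4 * s) (hz0 : 0 ≤ z.im)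
    (hz1 : ‖z‖ ≤ 1) (hz2 : 2 * s < ‖z‖) (hz : -s ≤ z.re ∨ w / 4 * -z.re ≤ z.im) :
    ∀ t ∈ Set.Icc (1 / 2 : ℝ) 1,
      Real.exp (s / 8 - 48 * (s / w) * (z.im / ‖z‖ ^ 2)) ≤ ‖1 - t * (e / z)‖ ^ 2 := by
  rintro t ⟨ht1, ht2⟩
  have hr : 0 < ‖z‖ := by linarith
  have hz_ne : z ≠ 0 := norm_pos_iff.1 hr
  have hzsq : ‖z‖ ^ 2 = z.re ^ 2 + z.im ^ 2 := by
    rw [← Complex.normSq_eq_norm_sq, Complex.normSq_apply]; ring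
  have hesq : ‖e‖ ^ 2 = s ^ 2 + e.im ^ 2 := by
    rw [← Complex.normSq_eq_norm_sq, Complex.normSq_apply, her]; ring
  have hei' : e.im ≤ s / 4 := by nlinarith
  have hS0 : 0 ≤ z.im / ‖z‖ ^ 2 := by positivity
  by_cases hc : ‖z‖ / 2 ≤ z.re
  · -- The zero lies to the right: moving left increases the factor.
    have hzi : z.im ≤ ‖z‖ := (le_abs_self _).trans (Complex.abs_im_le_norm z)
    have h1 : s / (4 * ‖z‖) ≤ -((z.re * e.re + z.im * e.im) / ‖z‖ ^ 2) := by
      rw [← neg_div, div_le_div_iff₀ (by positivity) (by positivity), her]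
      have h2 : z.im * e.im ≤ ‖z‖ * (s / 4) := by gcongr
      have h3 : s * (‖z‖ / 2) ≤ s * z.re := by gcongr
      have h5 : s * ‖z‖ / 4 ≤ -(z.re * -s + z.im * e.im) := by linarith
      calc s * ‖z‖ ^ 2 = s * ‖z‖ / 4 * (4 * ‖z‖) := by ring
        _ ≤ _ := by gcongr
    have h4 : s / 4 ≤ s / (4 * ‖z‖) := by
      gcongr
      linarith
    rw [norm_one_sub_mul_div_sq t e hz_ne]
    have h5 : Real.exp (s / 8 - 48 * (s / w) * (z.im / ‖z‖ ^ 2)) ≤ Real.exp (s / 8) :=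
      Real.exp_le_exp.2 (by
        have : 0 ≤ 48 * (s / w) * (z.im / ‖z‖ ^ 2) := by positivity
        linarith)
    have h6 := Real.abs_exp_sub_one_le (x := s / 8)
      (by rw [abs_of_nonneg (by positivity)]; linarith)
    rw [abs_of_nonneg (by positivity : 0 ≤ s / 8)] at h6
    have h7 := le_abs_self (Real.exp (s / 8) - 1)
    have h8 : 1 / 2 * (s / 4) ≤ t * -((z.re * e.re + z.im * e.im) / ‖z‖ ^ 2) := by
      gcongr
      linarith
    linarith [sq_nonneg (t * (‖e‖ / ‖z‖))]
  · -- The zero is steep: the loss is paid by its inclination.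
    push Not at hc
    have hsteep : w / 8 * ‖z‖ ≤ z.im := by
      have hzi : w / 8 * ‖z‖ ≤ ‖z‖ / 8 := by nlinarith
      by_contra! hlt
      have hsq : z.im ^ 2 ≤ (‖z‖ / 8) ^ 2 := by gcongr; linarith
      have hneg : z.re ≤ -(‖z‖ / 2) := by
        by_contra! h
        have h2 : z.re ^ 2 < (‖z‖ / 2) ^ 2 := sq_lt_sq' h hc
        linarith [sq_nonneg ‖z‖]
      rcases hz with h | h
      · linarith
      · have h2 : w / 4 * (‖z‖ / 2) ≤ w / 4 * -z.re := by gcongr; linarith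
        linarith
    have hen : ‖e‖ ≤ 5 / 4 * s := by
      refine abs_le_of_sq_le_sq' ?_ (by positivity) |>.2
      rw [hesq]
      nlinarith
    set x := ‖e‖ / ‖z‖ with hx
    have hx0 : 0 ≤ x := by positivity
    have hx1 : x ≤ 5 / 4 * (s / ‖z‖) := by
      rw [hx, ← mul_div_assoc]; gcongr
    have hsr : s / ‖z‖ ≤ 1 / 2 := by
      rw [div_le_iff₀ hr]; linarith
    have h1 : (1 - x) ^ 2 ≤ ‖1 - t * (e / z)‖ ^ 2 := by
      have h3 := norm_sub_norm_le (1 : ℂ) (t * (e / z))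
      rw [norm_one, norm_mul, Complex.norm_real, Real.norm_eq_abs,
        abs_of_nonneg (by linarith : (0 : ℝ) ≤ t), norm_div, ← hx] at h3
      have h4 : t * x ≤ x := by nlinarith
      have h5 : 0 ≤ 1 - x := by linarith
      gcongr
      linarith
    refine le_trans ?_ h1
    have hexp : s / 8 - 48 * (s / w) * (z.im / ‖z‖ ^ 2) ≤ -(5 * (s / ‖z‖)) := by
      have h3 : w / 8 / ‖z‖ ≤ z.im / ‖z‖ ^ 2 := by
        rw [div_le_div_iff₀ hr (by positivity)]
        nlinarith
      have h4 : 48 * (s / w) * (w / 8 / ‖z‖) = 6 * (s / ‖z‖) := by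
        field_simp; norm_num
      have h5 : 48 * (s / w) * (w / 8 / ‖z‖) ≤ 48 * (s / w) * (z.im / ‖z‖ ^ 2) := by gcongr
      have h6 : s ≤ s / ‖z‖ := by
        rw [le_div_iff₀ hr]; nlinarith
      linarith
    have h3 : Real.exp (s / 8 - 48 * (s / w) * (z.im / ‖z‖ ^ 2)) ≤
        Real.exp (-(5 / 2 * (s / ‖z‖))) ^ 2 := by
      rw [← Real.exp_nat_mul]
      refine Real.exp_le_exp.2 ?_
      push_cast
      linarith
    refine h3.trans ?_
    have h4 : Real.exp (-(5 / 2 * (s / ‖z‖))) ≤ 1 - 5 / 4 * (s / ‖z‖) := by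
      exact exp_neg_le (by positivity) hsr
    have h5 : Real.exp (-(5 / 2 * (s / ‖z‖))) ≤ 1 - x := by linarith
    gcongr

/-! ### The lower bound in terms of the width, for a family of zeros -/

/-- If the vertical segment of height `w * s / 2` at the maximum point `0` lies in `K`, then only few
zeros are close to `0`: they would make `∏ (1 - v / z_j)` exceed `1` somewhere on that segment. -/
lemma card_near_le {ι : Type*} [Fintype ι] {K : Set ℂ} {z : ι → ℂ} {m w s : ℝ}
    (hz_ne : ∀ j, z j ≠ 0) (hz_im : ∀ j, 0 ≤ (z j).im)
    (hmax : ∀ v ∈ K, ∏ j, ‖1 - v / z j‖ ≤ 1) (hm : ∑ j, (z j).im / ‖z j‖ ^ 2 ≤ m)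
    (hw0 : 0 < w) (hw1 : w ≤ 1) (hs : 0 < s)
    (hseg : ∀ y : ℝ, 0 ≤ y → y ≤ w * s / 2 → (y : ℂ) * Complex.I ∈ K) :
    ((Finset.univ.filter fun j => ‖z j‖ ≤ 2 * s).card : ℝ) * w ≤ 128000 * s * m := by
  set h := w * s / 2 with hh
  have hh0 : 0 < h := by positivity
  have hr : ∀ j, 0 < ‖z j‖ := fun j => norm_pos_iff.2 (hz_ne j)
  have hsum := sum_exponents_nonpos (fun j => (h * Complex.I) / z j)
    (fun j => min 1 ((h / ‖z j‖) ^ 2) / 16 - 1000 * (h / ‖z j‖ * ((z j).im / ‖z j‖)))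
    (fun j => by
      have hn : ‖(h : ℂ) * Complex.I‖ = h := by simp [abs_of_pos hh0]
      have hS1 : (z j).im / ‖z j‖ ≤ 1 := by
        rw [div_le_one (hr j)]
        exact (le_abs_self _).trans (Complex.abs_im_le_norm _)
      have hQ : 0 < h / ‖z j‖ := div_pos hh0 (hr j)
      rcases exp_vertical_le hQ (div_nonneg (hz_im j) (hr j).le) hS1 with h1 | h1
      · left
        intro t ht
        rw [norm_one_sub_mul_div_sq t _ (hz_ne j), hn]
        refine (h1 t ht).trans (le_of_eq ?_)
        have := (hr j).ne'
        simp only [Complex.mul_re, Complex.mul_im, Complex.ofReal_re, Complex.ofReal_im,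
          Complex.I_re, Complex.I_im]
        field_simp
        ring
      · right
        rwa [norm_div, hn])
    (fun t ht => by
      have := hmax (((t * h : ℝ) : ℂ) * Complex.I)
        (hseg _ (by have := ht.1; positivity) (by have := ht.2; nlinarith))
      refine le_trans (le_of_eq (Finset.prod_congr rfl fun j _ => ?_)) this
      push_cast
      rw [← mul_div_assoc, mul_assoc])
  have h1 : ∑ j, (min 1 ((h / ‖z j‖) ^ 2) / 16 - 1000 * (h / ‖z j‖ * ((z j).im / ‖z j‖)))
      = (∑ j, min 1 ((h / ‖z j‖) ^ 2)) / 16 - 1000 * h * ∑ j, (z j).im / ‖z j‖ ^ 2 := by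
    rw [Finset.sum_sub_distrib, Finset.sum_div, Finset.mul_sum]
    congr 1
    refine Finset.sum_congr rfl fun j _ => ?_
    have := (hr j).ne'
    field_simp
  rw [h1] at hsum
  have h2 : ((Finset.univ.filter fun j => ‖z j‖ ≤ 2 * s).card : ℝ) * (w ^ 2 / 16) ≤
      ∑ j, min 1 ((h / ‖z j‖) ^ 2) := by
    rw [← nsmul_eq_mul]
    refine le_trans (Finset.card_nsmul_le_sum _ (fun j => min 1 ((h / ‖z j‖) ^ 2)) _ ?_)
      (Finset.sum_le_sum_of_subset_of_nonneg (Finset.filter_subset _ _)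
        fun j _ _ => by positivity)
    intro j hj
    have hj' : ‖z j‖ ≤ 2 * s := (Finset.mem_filter.1 hj).2
    refine le_min (by nlinarith) ?_
    have h3 : w / 4 ≤ h / ‖z j‖ := by
      rw [le_div_iff₀ (hr j), hh]; nlinarith
    calc w ^ 2 / 16 = (w / 4) ^ 2 := by ring
      _ ≤ _ := by gcongr
  set N : ℝ := ((Finset.univ.filter fun j => ‖z j‖ ≤ 2 * s).card : ℝ)
  have h4 : 1000 * h * ∑ j, (z j).im / ‖z j‖ ^ 2 ≤ 1000 * h * m := by gcongr
  have h5 : w * (N * w) ≤ w * (128000 * s * m) := by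
    have h6 : N * (w ^ 2 / 16) ≤ 16000 * h * m := by linarith
    rw [hh] at h6
    linarith
  exact le_of_mul_le_mul_left h5 hw0

/-- The vertical chord of a convex set `K` at an interior abscissa `0`, from which `K` extends at
least `s` to both sides: if `K` has a point of height `w`, this chord has length at least
`w * s / 2`. -/
lemma vertical_mem {K : Set ℂ} (hK : Convex ℝ K) (h0 : (0 : ℂ) ∈ K) (hKim : ∀ v ∈ K, 0 ≤ v.im)
    (hK1 : ∀ v ∈ K, ‖v‖ ≤ 1) {w s : ℝ} (hw0 : 0 < w) (hs : 0 < s) {v e e' : ℂ} (hv : v ∈ K)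
    (hvw : w ≤ v.im) (he : e ∈ K) (hes : e.re ≤ -s) (he' : e' ∈ K) (hes' : s ≤ e'.re) :
    ∀ y : ℝ, 0 ≤ y → y ≤ w * s / 2 → (y : ℂ) * Complex.I ∈ K := by
  have habs : ∀ v ∈ K, |v.re| ≤ 1 := fun v hv => (Complex.abs_re_le_norm v).trans (hK1 v hv)
  -- The segment from `v` to the end point on the other side crosses the imaginary axis.
  have key : ∃ H : ℝ, w * s / 2 ≤ H ∧ (H : ℂ) * Complex.I ∈ K := by
    have cross : ∀ e ∈ K, s ≤ |e.re| → e.re * v.re ≤ 0 →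
        ∃ H : ℝ, w * s / 2 ≤ H ∧ (H : ℂ) * Complex.I ∈ K := by
      intro e he hes hopp
      have hv1 := habs v hv
      have he1 := habs e he
      set a := |e.re| / (|e.re| + |v.re|) with ha
      set b := |v.re| / (|e.re| + |v.re|) with hb
      have hD : 0 < |e.re| + |v.re| := by have := abs_nonneg v.re; linarith
      have ha0 : 0 ≤ a := by positivity
      have hb0 : 0 ≤ b := by positivity
      have hab : a + b = 1 := by rw [ha, hb, ← add_div, div_self hD.ne']
      have hmem := hK hv he ha0 hb0 hab
      have hre : |e.re| * v.re + |v.re| * e.re = 0 := by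
        rcases le_total 0 e.re with h | h <;> rcases le_total 0 v.re with h' | h' <;>
          simp only [abs_of_nonneg, abs_of_nonpos, h, h'] <;> nlinarith
      refine ⟨a * v.im + b * e.im, ?_, ?_⟩
      · have h1 : s / 2 ≤ a := by
          rw [ha, le_div_iff₀ hD]; nlinarith [abs_nonneg v.re]
        have h2 : 0 ≤ b * e.im := mul_nonneg hb0 (hKim e he)
        have h3 : s / 2 * w ≤ a * v.im := by gcongr
        linarith
      · convert hmem using 1
        apply Complex.ext
        · have : a * v.re + b * e.re = (|e.re| * v.re + |v.re| * e.re) / (|e.re| + |v.re|) := by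
            rw [ha, hb]; ring
          rw [hre, zero_div] at this
          simpa using this.symm
        · simp
    rcases le_total 0 v.re with h | h
    · exact cross e he (by rw [abs_of_nonpos (by linarith)]; linarith) (by nlinarith)
    · exact cross e' he' (by rw [abs_of_nonneg (by linarith)]; linarith) (by nlinarith)
  obtain ⟨H, hH, hHK⟩ := key
  intro y hy0 hy1
  have hHpos : 0 < H := lt_of_lt_of_le (by positivity) hH
  have := hK.smul_mem_of_zero_mem h0 hHK (t := y / H)
    ⟨by positivity, by rw [div_le_one hHpos]; linarith⟩
  convert this using 1
  rw [Complex.real_smul]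
  push_cast
  have : (H : ℂ) ≠ 0 := by exact_mod_cast hHpos.ne'
  field_simp

/-- The width estimate when `e` is the leftmost point of `K` in the sector `Im v ≤ -(w / 4) Re v`,
and `K` extends at least as far to the right. Zeros at distance at most `2 s` from `0` are few, and
on the way from `0` to `e` all others increase the product, unless they are steep. -/
lemma width_mul_card_le_of_left {ι : Type*} [Fintype ι] {K : Set ℂ} {z : ι → ℂ} {m w s : ℝ}
    (hK : Convex ℝ K) (h0 : (0 : ℂ) ∈ K) (hKim : ∀ v ∈ K, 0 ≤ v.im) (hK1 : ∀ v ∈ K, ‖v‖ ≤ 1)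
    (hz : ∀ j, z j ∈ K) (hz_ne : ∀ j, z j ≠ 0)
    (hmax : ∀ v ∈ K, ∏ j, ‖1 - v / z j‖ ≤ 1) (hm : ∑ j, (z j).im / ‖z j‖ ^ 2 ≤ m)
    (hw0 : 0 < w) {v e e' : ℂ} (hv : v ∈ K) (hvw : w ≤ v.im) (hs : 0 < s)
    (he : e ∈ K) (her : e.re = -s) (hei : e.im ≤ w / 4 * s)
    (hext : ∀ v ∈ K, -s ≤ v.re ∨ w / 4 * -v.re ≤ v.im) (he' : e' ∈ K) (hes' : s ≤ e'.re) :
    w * Fintype.card ι ≤ 8000000 * m := by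
  have hw1 : w ≤ 1 := hvw.trans ((le_abs_self _).trans
    ((Complex.abs_im_le_norm v).trans (hK1 v hv)))
  have hz_im : ∀ j, 0 ≤ (z j).im := fun j => hKim _ (hz j)
  have hr : ∀ j, 0 < ‖z j‖ := fun j => norm_pos_iff.2 (hz_ne j)
  have hnear := card_near_le hz_ne hz_im hmax hm hw0 hw1 hs
    (vertical_mem hK h0 hKim hK1 hw0 hs hv hvw he her.le he' hes')
  have hs1 : s ≤ 1 := by
    have := (Complex.abs_re_le_norm e).trans (hK1 e he)
    rwa [her, abs_neg, abs_of_pos hs] at this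
  have hse : s ≤ ‖e‖ := by
    have := Complex.abs_re_le_norm e
    rwa [her, abs_neg, abs_of_pos hs] at this
  classical
  have hsum := sum_exponents_nonpos (fun j => e / z j)
    -- The near zeros satisfy `|e / z_j| ≥ 1/2`, and `exp (-6) ≤ (1/16)²`.
    (fun j => (if ‖z j‖ ≤ 2 * s then (-7 : ℝ) else 0)
      + (s / 8 - 48 * (s / w) * ((z j).im / ‖z j‖ ^ 2)))
    (fun j => by
      by_cases hj : ‖z j‖ ≤ 2 * s
      · right
        have hS : 0 ≤ 48 * (s / w) * ((z j).im / ‖z j‖ ^ 2) := by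
          have := hz_im j; positivity
        have h1 : Real.exp ((if ‖z j‖ ≤ 2 * s then (-7 : ℝ) else 0)
            + (s / 8 - 48 * (s / w) * ((z j).im / ‖z j‖ ^ 2))) ≤ Real.exp (-6) :=
          Real.exp_le_exp.2 (by rw [if_pos hj]; linarith)
        have h6 : Real.exp (-6 : ℝ) ≤ 1 / 256 := by
          rw [Real.exp_neg, ← one_div]
          refine one_div_le_one_div_of_le (by norm_num) ?_
          have h8 : Real.exp 6 = Real.exp 1 ^ 6 := by rw [← Real.exp_nat_mul]; norm_num
          rw [h8]
          have h9 : (2.7 : ℝ) ≤ Real.exp 1 := by linarith [Real.exp_one_gt_d9]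
          calc (256 : ℝ) ≤ 2.7 ^ 6 := by norm_num
            _ ≤ _ := by gcongr
        have h2 : 1 / 2 ≤ ‖e / z j‖ := by
          rw [norm_div, le_div_iff₀ (hr j)]; linarith
        refine (h1.trans h6).trans ?_
        calc (1 / 256 : ℝ) = (1 / 2 / 8) ^ 2 := by norm_num
          _ ≤ _ := by gcongr
      · left
        rw [if_neg hj, zero_add]
        exact exp_horizontal_le hs hw0 hw1 her (hKim e he) hei (hz_im j) (hK1 _ (hz j))
          (not_le.1 hj) (hext _ (hz j)))
    (fun t ht => by
      have := hmax ((t : ℂ) * e) (by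
        have := hK.smul_mem_of_zero_mem h0 he (t := t) ⟨by linarith [ht.1], ht.2⟩
        rwa [Complex.real_smul] at this)
      refine le_trans (le_of_eq (Finset.prod_congr rfl fun j _ => ?_)) this
      rw [mul_div_assoc])
  rw [Finset.sum_add_distrib, ← Finset.sum_filter, Finset.sum_const, nsmul_eq_mul,
    Finset.sum_sub_distrib, ← Finset.mul_sum, Finset.sum_const, nsmul_eq_mul,
    Finset.card_univ] at hsum
  set N : ℝ := ((Finset.univ.filter fun j => ‖z j‖ ≤ 2 * s).card : ℝ)
  set n : ℝ := (Fintype.card ι : ℝ)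
  have h1 : 48 * (s / w) * ∑ j, (z j).im / ‖z j‖ ^ 2 ≤ 48 * (s / w) * m := by gcongr
  have h2 : N ≤ 128000 * s * m / w := by rwa [le_div_iff₀ hw0]
  have h3 : n * (s / 8) ≤ 7 * (128000 * s * m / w) + 48 * (s / w) * m := by linarith
  have h4 : 7 * (128000 * s * m / w) + 48 * (s / w) * m = s * (896048 * m) / w := by ring
  rw [h4, le_div_iff₀ hw0] at h3
  have hm0 : 0 ≤ m := le_trans (Finset.sum_nonneg fun j _ => by
    have := hz_im j; positivity) hm
  have h5 : s * (w * n) ≤ s * (7168384 * m) := by linarith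
  have := le_of_mul_le_mul_left h5 hs
  linarith

/-- If all zeros in the upper half-plane lie to the right of, or above, the line of slope `-w / 4`,
then their reciprocals cannot cancel. -/
lemma width_mul_card_le_of_sector {ι : Type*} [Fintype ι] {z : ι → ℂ} {m w : ℝ}
    (hz_ne : ∀ j, z j ≠ 0) (hz1 : ∀ j, ‖z j‖ ≤ 1) (hz_im : ∀ j, 0 ≤ (z j).im)
    (hA : ‖∑ j, 1 / z j‖ ≤ m) (hw0 : 0 < w) (hw1 : w ≤ 1)
    (hsec : ∀ j, 0 ≤ (z j).re ∨ w / 4 * -(z j).re ≤ (z j).im) :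
    w * Fintype.card ι ≤ 10 * m := by
  have h1 : ∑ _j : ι, w ≤ ∑ j, (w * (1 / z j).re + 9 * -(1 / z j).im) := by
    refine Finset.sum_le_sum fun j _ => ?_
    have hr : 0 < Complex.normSq (z j) := Complex.normSq_pos.2 (hz_ne j)
    have h2 : w * (1 / z j).re + 9 * -(1 / z j).im =
        (w * (z j).re + 9 * (z j).im) / Complex.normSq (z j) := by
      rw [one_div, Complex.inv_re, Complex.inv_im]; ring
    rw [h2, le_div_iff₀ hr, Complex.normSq_apply]
    have hx := abs_le.1 ((Complex.abs_re_le_norm (z j)).trans (hz1 j))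
    have hy := abs_le.1 ((Complex.abs_im_le_norm (z j)).trans (hz1 j))
    have hy0 := hz_im j
    have h3 : (z j).im * (z j).im ≤ (z j).im := by nlinarith
    have h4 : w * ((z j).im * (z j).im) ≤ (z j).im := by nlinarith
    rcases le_total 0 (z j).re with h | h
    · have h5 : (z j).re * (z j).re ≤ (z j).re := by nlinarith
      nlinarith
    · have h6 : w / 4 * -(z j).re ≤ (z j).im := by
        rcases hsec j with h' | h'
        · have : (z j).re = 0 := le_antisymm h h'
          simpa [this] using hy0
        · exact h'
      have h5 : (z j).re * (z j).re ≤ -(z j).re := by nlinarith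
      nlinarith
  rw [Finset.sum_add_distrib, ← Finset.mul_sum, ← Finset.mul_sum, Finset.sum_neg_distrib,
    ← Complex.re_sum, ← Complex.im_sum, Finset.sum_const, nsmul_eq_mul, Finset.card_univ] at h1
  have h2 := abs_le.1 ((Complex.abs_re_le_norm (∑ j, 1 / z j)).trans hA)
  have h3 := abs_le.1 ((Complex.abs_im_le_norm (∑ j, 1 / z j)).trans hA)
  nlinarith

/-- The width estimate in normalised position: `K` lies in the closed upper half-plane and in the
unit disc, touches the real axis at `0`, and has a point of height `w`; the normalised polynomial
`∏ (1 - v / z_j)` attains its maximum modulus over `K` at `0`, and its derivative there is at most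
`m` in modulus. -/
lemma width_mul_card_le {ι : Type*} [Fintype ι] {K : Set ℂ} {z : ι → ℂ} {m w : ℝ}
    (hK : Convex ℝ K) (hKc : IsCompact K) (h0 : (0 : ℂ) ∈ K) (hKim : ∀ v ∈ K, 0 ≤ v.im)
    (hK1 : ∀ v ∈ K, ‖v‖ ≤ 1) (hz : ∀ j, z j ∈ K) (hz_ne : ∀ j, z j ≠ 0)
    (hmax : ∀ v ∈ K, ∏ j, ‖1 - v / z j‖ ≤ 1) (hA : ‖∑ j, 1 / z j‖ ≤ m)
    (hw0 : 0 < w) (hw : ∃ v ∈ K, w ≤ v.im) :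
    w * Fintype.card ι ≤ 8000000 * m := by
  obtain ⟨v, hv, hvw⟩ := hw
  have hw1 : w ≤ 1 := hvw.trans ((le_abs_self _).trans
    ((Complex.abs_im_le_norm v).trans (hK1 v hv)))
  have hm0 : 0 ≤ m := (norm_nonneg _).trans hA
  have hm : ∑ j, (z j).im / ‖z j‖ ^ 2 ≤ m := by
    have h1 : ∑ j, (z j).im / ‖z j‖ ^ 2 = -(∑ j, 1 / z j).im := by
      rw [Complex.im_sum, ← Finset.sum_neg_distrib]
      refine Finset.sum_congr rfl fun j _ => ?_
      rw [one_div, Complex.inv_im, Complex.normSq_eq_norm_sq]; ring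
    rw [h1]
    exact (neg_le_abs _).trans ((Complex.abs_im_le_norm _).trans hA)
  have hcl : IsCompact (K ∩ {v : ℂ | v.im ≤ w / 4 * -v.re}) :=
    hKc.inter_right (isClosed_le Complex.continuous_im
      (continuous_const.mul Complex.continuous_re.neg))
  have hcr : IsCompact (K ∩ {v : ℂ | v.im ≤ w / 4 * v.re}) :=
    hKc.inter_right (isClosed_le Complex.continuous_im (continuous_const.mul Complex.continuous_re))
  obtain ⟨e, he, hemin⟩ := hcl.exists_isMinOn ⟨0, h0, by simp⟩ Complex.continuous_re.continuousOn
  obtain ⟨e', he', hemax⟩ := hcr.exists_isMaxOn ⟨0, h0, by simp⟩ Complex.continuous_re.continuousOn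
  have heim : e.im ≤ w / 4 * -e.re := he.2
  have heim' : e'.im ≤ w / 4 * e'.re := he'.2
  have hext : ∀ v ∈ K, e.re ≤ v.re ∨ w / 4 * -v.re ≤ v.im := by
    intro v hv
    by_cases h : v.im ≤ w / 4 * -v.re
    · exact Or.inl (hemin ⟨hv, h⟩)
    · exact Or.inr (not_le.1 h).le
  have hext' : ∀ v ∈ K, v.re ≤ e'.re ∨ w / 4 * v.re ≤ v.im := by
    intro v hv
    by_cases h : v.im ≤ w / 4 * v.re
    · exact Or.inl (hemax ⟨hv, h⟩)
    · exact Or.inr (not_le.1 h).le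
  have hes : 0 ≤ -e.re := by
    have := hKim e he.1
    by_contra! h
    nlinarith
  have hes' : 0 ≤ e'.re := by
    have := hKim e' he'.1
    by_contra! h
    nlinarith
  have hrn : ∀ u : ℂ, ‖-(starRingEnd ℂ) u‖ = ‖u‖ := fun u => by rw [norm_neg, RCLike.norm_conj]
  rcases hes.eq_or_lt with hs0 | hs0
  · have := width_mul_card_le_of_sector hz_ne (fun j => hK1 _ (hz j)) (fun j => hKim _ (hz j)) hA
      hw0 hw1 (fun j => by
        rcases hext _ (hz j) with h | h
        · left; linarith
        · right; exact h)
    linarith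
  rcases hes'.eq_or_lt with hs0' | hs0'
  · have := width_mul_card_le_of_sector (z := fun j => -(starRingEnd ℂ) (z j)) (m := m)
      (fun j => by simpa using hz_ne j) (fun j => by rw [hrn]; exact hK1 _ (hz j))
      (fun j => by simpa using hKim _ (hz j))
      (by
        have h1 : ∑ j, 1 / -(starRingEnd ℂ) (z j) = -(starRingEnd ℂ) (∑ j, 1 / z j) := by
          rw [map_sum, ← Finset.sum_neg_distrib]
          refine Finset.sum_congr rfl fun j _ => ?_
          rw [map_div₀, map_one, div_neg]
        rw [h1, hrn]; exact hA)
      hw0 hw1 (fun j => by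
        rcases hext' _ (hz j) with h | h
        · left; simp; linarith
        · right; simpa using h)
    linarith
  rcases le_total (-e.re) e'.re with hle | hle
  · exact width_mul_card_le_of_left hK h0 hKim hK1 hz hz_ne hmax hm hw0 hv hvw hs0 he.1
      (by ring) heim (fun v hv => by rw [neg_neg]; exact hext v hv) he'.1 hle
  · -- Reflect at the imaginary axis.
    refine width_mul_card_le_of_left (K := {u | -(starRingEnd ℂ) u ∈ K})
      (z := fun j => -(starRingEnd ℂ) (z j)) (v := -(starRingEnd ℂ) v)
      (e := -(starRingEnd ℂ) e') (e' := -(starRingEnd ℂ) e) (s := e'.re)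
      ?_ (by simpa using h0) ?_ ?_ ?_ ?_ ?_ ?_ hw0 ?_ ?_ hs0' ?_ ?_ ?_ ?_ ?_ ?_
    · intro x hx y hy a b ha hb hab
      have := hK hx hy ha hb hab
      change -(starRingEnd ℂ) (a • x + b • y) ∈ K
      convert this using 1
      simp only [Complex.real_smul, map_add, map_mul, Complex.conj_ofReal]
      ring
    · intro u hu
      simpa using hKim _ hu
    · intro u hu
      rw [← hrn]; exact hK1 _ hu
    · intro j; simpa using hz j
    · intro j; simpa using hz_ne j
    · intro u hu
      refine le_trans (le_of_eq (Finset.prod_congr rfl fun j _ => ?_)) (hmax _ hu)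
      rw [← RCLike.norm_conj, map_sub, map_one, map_div₀, map_neg, Complex.conj_conj, neg_div,
        div_neg]
    · simpa using hm
    · simpa using hv
    · simpa using hvw
    · simpa using he'.1
    · simp
    · simpa using heim'
    · intro u hu
      rcases hext' _ hu with h | h
      · left; simp at h; linarith
      · right; simpa using h
    · simpa using he.1
    · simpa using hle

/-! ### The lower bound of order `√n`, for a family of zeros -/

/-- In normalised position, if the derivative of `∏ (1 - v / z_j)` is at most `m` in modulus on `K`,
then there are at most `18 m²` zeros: otherwise the logarithmic derivative would change too much
between `0` and a point of `K` at distance `1 / (4 m)`. -/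
lemma card_le_sq {ι : Type*} [Fintype ι] {K : Set ℂ} {z : ι → ℂ} {m : ℝ}
    (hK : Convex ℝ K) (h0 : (0 : ℂ) ∈ K) (hKim : ∀ v ∈ K, 0 ≤ v.im) (hK1 : ∀ v ∈ K, ‖v‖ ≤ 1)
    (hz : ∀ j, z j ∈ K) (hz_ne : ∀ j, z j ≠ 0)
    (hmv : ∀ v ∈ K, 1 - m * ‖v‖ ≤ ∏ j, ‖1 - v / z j‖)
    (hder : ∀ v ∈ K, ‖∑ j, 1 / (v - z j)‖ * ∏ j, ‖1 - v / z j‖ ≤ m)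
    {v₀ : ℂ} (hv₀ : v₀ ∈ K) (hv₀n : 1 / 2 ≤ ‖v₀‖) :
    (Fintype.card ι : ℝ) ≤ 18 * m ^ 2 := by
  rcases isEmpty_or_nonempty ι with hι | ⟨⟨j₀⟩⟩
  · simp; positivity
  have hr : ∀ j, 0 < ‖z j‖ := fun j => norm_pos_iff.2 (hz_ne j)
  have hmr : ∀ j, 1 ≤ m * ‖z j‖ := by
    intro j
    have h1 := hmv (z j) (hz j)
    rw [Finset.prod_eq_zero (Finset.mem_univ j) (by rw [div_self (hz_ne j)]; simp)] at h1
    linarith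
  have hm1 : 1 ≤ m := by
    have h1 := hmr j₀
    have h2 := hK1 _ (hz j₀)
    have h3 := hr j₀
    by_contra! h
    nlinarith
  have hm0 : 0 < m := by linarith
  obtain ⟨v, hv, hvn⟩ : ∃ v ∈ K, ‖v‖ = 1 / (4 * m) := by
    have hv0 : 0 < ‖v₀‖ := by linarith
    refine ⟨(1 / (4 * m) / ‖v₀‖ : ℝ) • v₀, hK.smul_mem_of_zero_mem h0 hv₀ ⟨by positivity, ?_⟩, ?_⟩
    · rw [div_le_one hv0]
      refine le_trans ?_ hv₀n
      rw [div_le_div_iff₀ (by positivity) (by norm_num)]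
      linarith
    · rw [norm_smul, Real.norm_eq_abs, abs_of_pos (by positivity), div_mul_cancel₀ _ hv0.ne']
  have hA0 : ‖∑ j, 1 / z j‖ ≤ m := by
    have := hder 0 h0
    simpa [Finset.sum_neg_distrib, ← neg_inv] using this
  have hAv : ‖∑ j, 1 / (v - z j)‖ ≤ 4 / 3 * m := by
    have h1 := hder v hv
    have h2 := hmv v hv
    have h3 : m * ‖v‖ = 1 / 4 := by rw [hvn]; field_simp
    have h4 := norm_nonneg (∑ j, 1 / (v - z j))
    nlinarith
  have hu : ∀ j, ‖v / z j‖ ≤ 1 / 4 := by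
    intro j
    rw [norm_div, hvn, div_le_iff₀ (hr j), div_le_iff₀ (by positivity)]
    linarith [hmr j]
  have hone : ∀ j, 3 / 4 ≤ ‖1 - v / z j‖ := by
    intro j
    have := norm_sub_norm_le (1 : ℂ) (v / z j)
    rw [norm_one] at this
    linarith [hu j]
  have hvz : ∀ j, 1 - v / z j ≠ 0 := fun j => norm_pos_iff.1 (by linarith [hone j])
  have hvz' : ∀ j, v - z j ≠ 0 := by
    intro j h
    apply hvz j
    rw [sub_eq_zero.1 h, div_self (hz_ne j), sub_self]
  set B := ∑ j, 1 / (z j ^ 2 * (1 - v / z j)) with hB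
  have hdiff : ∑ j, 1 / (v - z j) + ∑ j, 1 / z j = -v * B := by
    rw [← Finset.sum_add_distrib, hB, Finset.mul_sum]
    refine Finset.sum_congr rfl fun j _ => ?_
    have h1 : z j ^ 2 * (1 - v / z j) = -(z j * (v - z j)) := by
      have := hz_ne j
      field_simp
      ring
    rw [h1]
    have := hz_ne j
    have := hvz' j
    field_simp
    ring
  have hBn : ‖B‖ ≤ 28 / 3 * m ^ 2 := by
    have h1 : ‖-v * B‖ ≤ 7 / 3 * m := by
      rw [← hdiff]
      refine (norm_add_le _ _).trans ?_
      linarith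
    rw [norm_mul, norm_neg, hvn, div_mul_eq_mul_div, one_mul, div_le_iff₀ (by positivity)] at h1
    linarith
  have hpt : ∀ j, 2 / 3 - 2 * m * -(1 / z j).im ≤ (1 / (z j ^ 2 * (1 - v / z j))).re := by
    intro j
    set a := 1 / z j with ha
    have haim : 0 ≤ -a.im := by
      rw [ha, one_div, Complex.inv_im, neg_div, neg_neg]
      exact div_nonneg (hKim _ (hz j)) (Complex.normSq_nonneg _)
    have hna : ‖a‖ = 1 / ‖z j‖ := by rw [ha, norm_div, norm_one]
    have hna1 : 1 ≤ ‖a‖ := by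
      rw [hna, le_div_iff₀ (hr j)]; linarith [hK1 _ (hz j)]
    have hnam : ‖a‖ ≤ m := by
      rw [hna, div_le_iff₀ (hr j)]; exact hmr j
    have hsplit : 1 / (z j ^ 2 * (1 - v / z j)) = a ^ 2 + a ^ 2 * (v / z j / (1 - v / z j)) := by
      have := hz_ne j
      have := hvz j
      rw [ha]
      generalize v / z j = q at *
      field_simp
      ring
    have hrest : ‖a ^ 2 * (v / z j / (1 - v / z j))‖ ≤ ‖a‖ ^ 2 / 3 := by
      rw [norm_mul, norm_pow, norm_div (v / z j)]
      have h1 : ‖v / z j‖ / ‖1 - v / z j‖ ≤ 1 / 3 := by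
        rw [div_le_iff₀ (by linarith [hone j])]
        linarith [hone j, hu j]
      have := mul_le_mul_of_nonneg_left h1 (sq_nonneg ‖a‖)
      linarith
    have h2 := neg_le_of_abs_le ((Complex.abs_re_le_norm _).trans hrest)
    have h3 : (a ^ 2).re = ‖a‖ ^ 2 - 2 * a.im ^ 2 := by
      rw [← Complex.normSq_eq_norm_sq, Complex.normSq_apply, sq, Complex.mul_re]; ring
    have h4 : -a.im ≤ ‖a‖ := (neg_le_abs _).trans (Complex.abs_im_le_norm a)
    have h5 : (-a.im) * (-a.im) ≤ m * (-a.im) := by gcongr; linarith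
    rw [hsplit, Complex.add_re, h3]
    nlinarith
  have hsum := Finset.sum_le_sum fun j (_ : j ∈ Finset.univ) => hpt j
  rw [← Complex.re_sum, Finset.sum_sub_distrib, ← Finset.mul_sum, Finset.sum_neg_distrib,
    ← Complex.im_sum, Finset.sum_const, nsmul_eq_mul, Finset.card_univ] at hsum
  have h1 : -(∑ j, 1 / z j).im ≤ m :=
    (neg_le_abs _).trans ((Complex.abs_im_le_norm _).trans hA0)
  have h2 : B.re ≤ 28 / 3 * m ^ 2 := (le_abs_self _).trans ((Complex.abs_re_le_norm B).trans hBn)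
  have h3 : 2 * m * -(∑ j, 1 / z j).im ≤ 2 * m * m := by gcongr
  have h4 : (Fintype.card ι : ℝ) * (2 / 3) - 2 * m * m ≤ 28 / 3 * m ^ 2 := by linarith
  nlinarith

/-! ### Suprema of polynomials over compact sets -/

lemma bddAbove_range_norm_eval {K : Set ℂ} (hK : IsCompact K) (P : Polynomial ℂ) :
    BddAbove (Set.range fun z : K => ‖P.eval (z : ℂ)‖) := by
  have h := hK.bddAbove_image (f := fun z => ‖P.eval z‖) P.continuous.norm.continuousOn
  rwa [Set.image_eq_range] at h

lemma norm_eval_le_supNormOn {K : Set ℂ} (hK : IsCompact K) (P : Polynomial ℂ) {z : ℂ}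
    (hz : z ∈ K) : ‖P.eval z‖ ≤ supNormOn K P :=
  le_ciSup (bddAbove_range_norm_eval hK P) ⟨z, hz⟩

lemma supNormOn_le {K : Set ℂ} (hK : K.Nonempty) (P : Polynomial ℂ) {C : ℝ}
    (h : ∀ z ∈ K, ‖P.eval z‖ ≤ C) : supNormOn K P ≤ C :=
  have := hK.to_subtype
  ciSup_le fun z => h z z.2

lemma supNormOn_nonneg (K : Set ℂ) (P : Polynomial ℂ) : 0 ≤ supNormOn K P :=
  Real.iSup_nonneg fun _ => norm_nonneg _

lemma exists_norm_eval_eq_supNormOn {K : Set ℂ} (hK : IsCompact K) (hne : K.Nonempty)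
    (P : Polynomial ℂ) : ∃ ζ ∈ K, ‖P.eval ζ‖ = supNormOn K P := by
  obtain ⟨ζ, hζ, hmax⟩ := hK.exists_isMaxOn hne (f := fun z => ‖P.eval z‖)
    P.continuous.norm.continuousOn
  exact ⟨ζ, hζ, le_antisymm (norm_eval_le_supNormOn hK P hζ) (supNormOn_le hne P hmax)⟩

lemma supNormOn_pos {K : Set ℂ} (hK : IsCompact K) (hinf : K.Infinite) {P : Polynomial ℂ}
    (hP : P ≠ 0) : 0 < supNormOn K P := by
  obtain ⟨z, hz, hzr⟩ := hinf.exists_notMem_finset P.roots.toFinset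
  refine lt_of_lt_of_le (norm_pos_iff.2 fun h => hzr ?_) (norm_eval_le_supNormOn hK P hz)
  rw [Multiset.mem_toFinset, Polynomial.mem_roots hP]
  exact h

lemma exists_dist_eq_diam {K : Set ℂ} (hK : IsCompact K) (hne : K.Nonempty) :
    ∃ x ∈ K, ∃ y ∈ K, dist x y = Metric.diam K := by
  obtain ⟨⟨x, y⟩, ⟨hx, hy⟩, hmax⟩ := (hK.prod hK).exists_isMaxOn (hne.prod hne)
    continuous_dist.continuousOn
  exact ⟨x, hx, y, hy, le_antisymm (Metric.dist_le_diam_of_mem hK.isBounded hx hy)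
    (Metric.diam_le_of_forall_dist_le dist_nonneg fun a ha b hb => hmax (Set.mk_mem_prod ha hb))⟩

/-! ### Support lines at maximum points -/

/-- By the maximum principle a nonconstant polynomial attains its maximum modulus over `K` on the
boundary only. -/
lemma notMem_interior_of_isMax {K : Set ℂ} {P : Polynomial ℂ} (hP : 0 < P.degree) {ζ : ℂ}
    (hmax : ∀ z ∈ K, ‖P.eval z‖ ≤ ‖P.eval ζ‖) : ζ ∉ interior K := by
  intro hζ
  have hloc : IsLocalMax (norm ∘ fun z => P.eval z) ζ := by
    filter_upwards [mem_interior_iff_mem_nhds.1 hζ] with z hz using hmax z hz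
  have hev := Complex.eventually_eq_of_isLocalMax_norm
    (Filter.Eventually.of_forall fun z => P.differentiable z) hloc
  have hinf : Set.Infinite {x | P.eval x = (Polynomial.C (P.eval ζ)).eval x} := by
    refine infinite_of_mem_nhds ζ ?_
    filter_upwards [hev] with z hz
    simpa using hz
  rw [Polynomial.eq_of_infinite_eval_eq _ _ hinf] at hP
  exact absurd hP (not_lt.2 Polynomial.degree_C_le)

/-- A support line at a boundary point of a convex set in the plane, normalised to be the real
axis. -/
lemma exists_support {K : Set ℂ} (hK : Convex ℝ K) {ζ : ℂ} (hζK : ζ ∈ K) (hζ : ζ ∉ interior K) :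
    ∃ u : ℂ, ‖u‖ = 1 ∧ ∀ z ∈ K, 0 ≤ ((z - ζ) / u).im := by
  obtain ⟨f, hf0, hf⟩ : ∃ f : ℂ →ₗ[ℝ] ℝ, f ≠ 0 ∧ ∀ z ∈ K, f z ≤ f ζ := by
    by_cases hne : (interior K).Nonempty
    · obtain ⟨f, hf⟩ := geometric_hahn_banach_open_point hK.interior isOpen_interior hζ
      refine ⟨f, ?_, fun z hz => ?_⟩
      · rintro h
        obtain ⟨a, ha⟩ := hne
        have h1 := hf a ha
        have h2 : ∀ x, f x = 0 := fun x => by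
          have := LinearMap.congr_fun h x
          simpa using this
        rw [h2, h2] at h1
        exact lt_irrefl _ h1
      · have h1 : closure (interior K) ⊆ {x | f x ≤ f ζ} :=
          closure_minimal (fun a ha => (hf a ha).le) (isClosed_le f.continuous continuous_const)
        rw [hK.closure_interior_eq_closure_of_nonempty_interior hne] at h1
        exact h1 (subset_closure hz)
    · -- A convex set without interior lies on a line.
      have hspan : affineSpan ℝ K ≠ ⊤ := fun h =>
        hne (hK.interior_nonempty_iff_affineSpan_eq_top.2 h)
      have hdir : (affineSpan ℝ K).direction ≠ ⊤ := fun h => hspan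
        ((AffineSubspace.direction_eq_top_iff_of_nonempty
          ⟨ζ, subset_affineSpan ℝ K hζK⟩).1 h)
      obtain ⟨f, hf0, hf⟩ := Submodule.exists_le_ker_of_lt_top _ (lt_top_iff_ne_top.2 hdir)
      refine ⟨f, hf0, fun z hz => ?_⟩
      have h1 := hf (AffineSubspace.vsub_mem_direction (subset_affineSpan ℝ K hz)
        (subset_affineSpan ℝ K hζK))
      rw [LinearMap.mem_ker, vsub_eq_sub, map_sub] at h1
      linarith
  have hfv : ∀ v : ℂ, f v = v.re * f 1 + v.im * f Complex.I := by
    intro v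
    conv_lhs => rw [← Complex.re_add_im v]
    rw [map_add, ← mul_one (v.re : ℂ), ← Complex.real_smul, ← Complex.real_smul, map_smul, map_smul,
      smul_eq_mul, smul_eq_mul]
  set c : ℂ := ⟨-f Complex.I, f 1⟩ with hc
  have hc0 : c ≠ 0 := by
    intro h
    apply hf0
    have h1 : f Complex.I = 0 := by simpa [hc] using congrArg Complex.re h
    have h2 : f 1 = 0 := by simpa [hc] using congrArg Complex.im h
    ext v
    rw [hfv, h1, h2]; simp
  have hcn : 0 < ‖c‖ := norm_pos_iff.2 hc0
  refine ⟨c / ‖c‖, by rw [norm_div, Complex.norm_real, norm_norm, div_self hcn.ne'],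
    fun z hz => ?_⟩
  have h1 : (z - ζ) / (c / ‖c‖) = (‖c‖ : ℝ) * ((z - ζ) / c) := by
    rw [div_div_eq_mul_div]; ring
  have h2 : ((z - ζ) / c).im = (f ζ - f z) / Complex.normSq c := by
    rw [Complex.div_im, hfv z, hfv ζ, hc]
    simp only [Complex.sub_re, Complex.sub_im]
    ring
  rw [h1, Complex.im_ofReal_mul, h2]
  exact mul_nonneg hcn.le (div_nonneg (sub_nonneg.2 (hf z hz)) (Complex.normSq_nonneg _))

/-! ### The lower bound for a polynomial -/

/-- The zeros of a complex polynomial as a finite family, with the product formula for the values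
and the partial fraction formula for the logarithmic derivative. -/
lemma exists_root_family (P : Polynomial ℂ) :
    ∃ a : Fin P.natDegree → ℂ, (∀ j, P ≠ 0 → P.IsRoot (a j)) ∧
      (∀ x, P.eval x = P.leadingCoeff * ∏ j, (x - a j)) ∧
      ∀ x, P.eval x ≠ 0 → P.derivative.eval x = P.eval x * ∑ j, 1 / (x - a j) := by
  have hsp := IsAlgClosed.splits P
  have hcard : P.roots.toList.length = P.natDegree := by
    rw [Multiset.length_toList, hsp.natDegree_eq_card_roots]
  rw [← hcard]
  refine ⟨fun j => P.roots.toList[j], fun j hP => ?_, fun x => ?_, fun x hx => ?_⟩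
  · have : P.roots.toList[j] ∈ P.roots.toList := List.getElem_mem _
    rw [Multiset.mem_toList] at this
    exact Polynomial.isRoot_of_mem_roots this
  · rw [hsp.eval_eq_prod_roots, ← Multiset.prod_map_toList]
    congr 1
    exact (Fin.prod_univ_fun_getElem P.roots.toList fun a => x - a).symm
  · rw [hsp.eval_derivative_eq_eval_mul_sum hx, ← Multiset.sum_map_toList]
    congr 1
    exact (Fin.sum_univ_fun_getElem P.roots.toList fun a => 1 / (x - a)).symm

lemma minWidth_le {K : Set ℂ} {δ a : ℝ} {u : ℂ} (hδ : 0 ≤ δ) (hu : ‖u‖ = 1)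
    (h : ∀ z ∈ K, a ≤ inner ℝ u z ∧ inner ℝ u z ≤ a + δ) : minWidth K ≤ δ :=
  csInf_le ⟨0, fun _ h => h.1⟩ ⟨hδ, u, hu, a, h⟩

/-- The two lower estimates for a single polynomial `P` with all zeros in `K`. Placing the origin at
a maximum point of `|P|`, the real axis along a support line and taking the diameter as unit of
length reduces them to the estimates for families of zeros in normalised position. -/
lemma lower_estimates {K : Set ℂ} (hKc : IsCompact K) (hK : Convex ℝ K) (hnt : K.Nontrivial)
    {n : ℕ} (hn : 1 ≤ n) {P : Polynomial ℂ} (hP : P ∈ polysWithZerosIn n K) :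
    minWidth K * n ≤ 8000000 * Metric.diam K ^ 2 *
        (supNormOn K P.derivative / supNormOn K P) ∧
      (n : ℝ) ≤ 18 * (Metric.diam K * (supNormOn K P.derivative / supNormOn K P)) ^ 2 := by
  obtain ⟨hdeg, hroots⟩ := hP
  have hnd : P.natDegree = n := Polynomial.natDegree_eq_of_degree_eq_some hdeg
  have hP0 : P ≠ 0 := by
    rintro rfl
    simp at hdeg
  have hinf : K.Infinite := hK.isPreconnected.infinite_of_nontrivial hnt
  have hpos := supNormOn_pos hKc hinf hP0
  obtain ⟨ζ, hζK, hζ⟩ := exists_norm_eval_eq_supNormOn hKc hnt.nonempty P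
  obtain ⟨u₀, hu₀, hsupp⟩ := exists_support hK hζK (notMem_interior_of_isMax (P := P)
    (by rw [hdeg]; exact_mod_cast hn) fun z hz => by
      rw [hζ]; exact norm_eval_le_supNormOn hKc P hz)
  set d := Metric.diam K with hd
  have hd0 : 0 < d := Metric.diam_pos hnt hKc.isBounded
  set M := supNormOn K P.derivative / supNormOn K P with hM
  have hM0 : 0 ≤ M := div_nonneg (supNormOn_nonneg _ _) hpos.le
  have hPζ : P.eval ζ ≠ 0 := norm_pos_iff.1 (by rw [hζ]; exact hpos)
  have hder' : ∀ x ∈ K, ‖P.derivative.eval x‖ ≤ M * ‖P.eval ζ‖ := by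
    intro x hx
    rw [hζ, hM, div_mul_cancel₀ _ hpos.ne']
    exact norm_eval_le_supNormOn hKc _ hx
  -- The change of coordinates `x = ζ + u v`.
  set u : ℂ := d * u₀ with hu
  have hun : ‖u‖ = d := by
    rw [hu, norm_mul, hu₀, mul_one, Complex.norm_real, Real.norm_eq_abs, abs_of_pos hd0]
  have hu_ne : u ≠ 0 := norm_pos_iff.1 (by rw [hun]; exact hd0)
  set K' : Set ℂ := (fun x => (x - ζ) / u) '' K with hK'
  have hmem : ∀ v ∈ K', ζ + u * v ∈ K := by
    rintro _ ⟨x, hx, rfl⟩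
    convert hx using 1
    field_simp
    ring
  have hK'c : IsCompact K' := hKc.image (by fun_prop)
  have hK'conv : Convex ℝ K' := by
    rintro _ ⟨x, hx, rfl⟩ _ ⟨y, hy, rfl⟩ α β hα hβ hαβ
    refine ⟨α • x + β • y, hK hx hy hα hβ hαβ, ?_⟩
    have : (α : ℂ) + β = 1 := by exact_mod_cast hαβ
    simp only [Complex.real_smul]
    field_simp
    linear_combination ζ * this
  have h0 : (0 : ℂ) ∈ K' := ⟨ζ, hζK, by simp⟩
  have himf : ∀ x, ((x - ζ) / u).im = ((x - ζ) / u₀).im / d := by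
    intro x
    rw [hu, mul_comm (d : ℂ), ← div_div, Complex.div_ofReal_im]
  have hK'im : ∀ v ∈ K', 0 ≤ v.im := by
    rintro _ ⟨x, hx, rfl⟩
    simp only [himf]
    exact div_nonneg (hsupp x hx) hd0.le
  have hK'1 : ∀ v ∈ K', ‖v‖ ≤ 1 := by
    rintro _ ⟨x, hx, rfl⟩
    rw [norm_div, hun, div_le_one hd0, ← dist_eq_norm]
    exact Metric.dist_le_diam_of_mem hKc.isBounded hx hζK
  obtain ⟨a, haroot, haeval, hader⟩ := exists_root_family P
  set z : Fin P.natDegree → ℂ := fun j => (a j - ζ) / u with hz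
  have hzK : ∀ j, z j ∈ K' := fun j => ⟨a j, hroots _ (haroot j hP0), rfl⟩
  have haζ : ∀ j, a j - ζ ≠ 0 := by
    intro j h
    apply hPζ
    rw [← sub_eq_zero.1 h]
    exact haroot j hP0
  have hz_ne : ∀ j, z j ≠ 0 := fun j => div_ne_zero (haζ j) hu_ne
  have hprod : ∀ v, ∏ j, ‖1 - v / z j‖ = ‖P.eval (ζ + u * v)‖ / ‖P.eval ζ‖ := by
    intro v
    have h1 : P.eval (ζ + u * v) / P.eval ζ = ∏ j, (1 - v / z j) := by
      have hl : P.leadingCoeff ≠ 0 := Polynomial.leadingCoeff_ne_zero.2 hP0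
      rw [haeval, haeval ζ, mul_div_mul_left _ _ hl, ← Finset.prod_div_distrib]
      refine Finset.prod_congr rfl fun j _ => ?_
      have h2 := haζ j
      have h3 : ζ - a j ≠ 0 := by rw [← neg_sub]; exact neg_ne_zero.2 h2
      rw [hz]
      field_simp
      ring
    rw [← norm_div, h1, norm_prod]
  have hmax : ∀ v ∈ K', ∏ j, ‖1 - v / z j‖ ≤ 1 := by
    intro v hv
    rw [hprod, hζ, div_le_one hpos]
    exact norm_eval_le_supNormOn hKc P (hmem v hv)
  have hder : ∀ v ∈ K', ‖∑ j, 1 / (v - z j)‖ * ∏ j, ‖1 - v / z j‖ ≤ d * M := by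
    intro v hv
    by_cases hv0 : P.eval (ζ + u * v) = 0
    · rw [hprod, hv0]; simp; positivity
    · have h1 : ∑ j, 1 / (v - z j) = u * ∑ j, 1 / (ζ + u * v - a j) := by
        rw [Finset.mul_sum]
        refine Finset.sum_congr rfl fun j _ => ?_
        have h2 : v - z j = (ζ + u * v - a j) / u := by
          rw [hz]; field_simp; ring
        rw [h2, one_div_div, mul_one_div]
      have h3 := hder' _ (hmem v hv)
      rw [hader _ hv0, norm_mul] at h3
      rw [hprod, h1, norm_mul, hun, mul_assoc, ← mul_div_assoc]
      gcongr
      rw [div_le_iff₀ (norm_pos_iff.2 hPζ)]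
      linarith
  have hmv : ∀ v ∈ K', 1 - d * M * ‖v‖ ≤ ∏ j, ‖1 - v / z j‖ := by
    intro v hv
    have h1 := hK.norm_image_sub_le_of_norm_hasDerivWithin_le (f := fun x => P.eval x)
      (fun x _ => (P.hasDerivAt x).hasDerivWithinAt) hder' hζK (hmem v hv)
    rw [add_sub_cancel_left, norm_mul, hun] at h1
    have h2 := norm_sub_norm_le (P.eval ζ) (P.eval (ζ + u * v))
    rw [norm_sub_rev] at h2
    rw [hprod, le_div_iff₀ (norm_pos_iff.2 hPζ)]
    linarith
  have hA : ‖∑ j, 1 / z j‖ ≤ d * M := by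
    have := hder 0 h0
    simpa [Finset.sum_neg_distrib, ← neg_inv] using this
  constructor
  · -- The highest point of `K'` bounds the width of `K`.
    obtain ⟨v, hv, hvmax⟩ := hK'c.exists_isMaxOn ⟨0, h0⟩ Complex.continuous_im.continuousOn
    have hv0 := hK'im v hv
    have hwidth : minWidth K ≤ d * v.im := by
      refine minWidth_le (u := Complex.I * u₀) (a := inner ℝ (Complex.I * u₀) ζ) (by positivity)
        (by rw [norm_mul, Complex.norm_I, hu₀, mul_one]) fun x hx => ?_
      have h1 : inner ℝ (Complex.I * u₀) x
          = inner ℝ (Complex.I * u₀) ζ + ((x - ζ) / u₀).im := by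
        have h2 : Complex.normSq u₀ = 1 := by rw [Complex.normSq_eq_norm_sq, hu₀, one_pow]
        rw [Complex.div_im, h2, Complex.inner, Complex.inner]
        simp
        ring
      have h2 : ((x - ζ) / u).im ≤ v.im := hvmax ⟨x, hx, rfl⟩
      rw [himf, div_le_iff₀ hd0] at h2
      rw [h1]
      exact ⟨by linarith [hsupp x hx], by linarith⟩
    rcases hv0.eq_or_lt with h | h
    · have h1 : minWidth K * n ≤ 0 := by
        rw [← h, mul_zero] at hwidth
        exact mul_nonpos_of_nonpos_of_nonneg hwidth (Nat.cast_nonneg n)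
      refine h1.trans (by positivity)
    · have h1 := width_mul_card_le hK'conv hK'c h0 hK'im hK'1 hzK hz_ne hmax hA h
        ⟨v, hv, le_rfl⟩
      rw [Fintype.card_fin, hnd] at h1
      calc minWidth K * n ≤ d * v.im * n := by gcongr
        _ = d * (v.im * n) := by ring
        _ ≤ d * (8000000 * (d * M)) := by gcongr
        _ = _ := by ring
  · -- Some point of `K` has at least half the diameter as its distance from `ζ`.
    obtain ⟨x, hx, hxd⟩ : ∃ x ∈ K, d / 2 ≤ dist x ζ := by
      obtain ⟨x, hx, y, hy, hxy⟩ := exists_dist_eq_diam hKc hnt.nonempty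
      by_contra! h
      linarith [h x hx, h y hy, dist_triangle_right x y ζ]
    have h1 := card_le_sq hK'conv h0 hK'im hK'1 hzK hz_ne hmv hder (v₀ := (x - ζ) / u)
      ⟨x, hx, rfl⟩ (by
        rw [norm_div, hun, ← dist_eq_norm, le_div_iff₀ hd0]
        linarith)
    rwa [Fintype.card_fin, hnd] at h1

lemma X_sub_C_pow_mem_polysWithZerosIn {K : Set ℂ} {x : ℂ} (hx : x ∈ K) (n : ℕ) :
    (Polynomial.X - Polynomial.C x) ^ n ∈ polysWithZerosIn n K := by
  refine ⟨?_, fun z hz => ?_⟩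
  · rw [Polynomial.degree_pow, Polynomial.degree_X_sub_C]; simp
  · have h : z - x = 0 := by
      simp only [Polynomial.IsRoot.def, Polynomial.eval_pow, Polynomial.eval_sub,
        Polynomial.eval_X, Polynomial.eval_C] at hz
      by_contra hne
      exact pow_ne_zero n hne hz
    rwa [sub_eq_zero.1 h]

theorem le_inverseMarkovFactor {K : Set ℂ} (hKc : IsCompact K) (hK : Convex ℝ K)
    (hnt : K.Nontrivial) {n : ℕ} (hn : 1 ≤ n) :
    1 / 8000000 * max (minWidth K * n / Metric.diam K ^ 2) (√n / Metric.diam K) ≤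
      inverseMarkovFactor n K := by
  have hd0 : 0 < Metric.diam K := Metric.diam_pos hnt hKc.isBounded
  obtain ⟨x, hx⟩ := hnt.nonempty
  refine le_csInf ⟨_, Set.mem_image_of_mem _ (X_sub_C_pow_mem_polysWithZerosIn hx n)⟩ ?_
  rintro _ ⟨P, hP, rfl⟩
  obtain ⟨h1, h2⟩ := lower_estimates hKc hK hnt hn hP
  set M := supNormOn K P.derivative / supNormOn K P with hM
  have hM0 : 0 ≤ M := div_nonneg (supNormOn_nonneg _ _) (supNormOn_nonneg _ _)
  rw [mul_max_of_nonneg _ _ (by norm_num)]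
  refine max_le ?_ ?_
  · rw [← mul_div_assoc, div_le_iff₀ (by positivity)]
    linarith
  · rw [← mul_div_assoc, div_le_iff₀ hd0]
    have h3 : √n ≤ 5 * (Metric.diam K * M) := by
      rw [Real.sqrt_le_left (by positivity)]
      nlinarith [sq_nonneg (Metric.diam K * M)]
    have h4 : 0 ≤ Metric.diam K * M := by positivity
    linarith

/-! ### The upper bound -/

/-- Away from the centre, the factor `|ξ² - 1|` is small enough for its powers to compensate the
factor `|ξ|` of the derivative of `(ξ - 1) ^ k * (ξ + 1) ^ k`. -/
lemma norm_sub_one_mul_norm_add_one_le {ξ : ℂ} {η : ℝ} (hre : |ξ.re| ≤ 1)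
    (him : ξ.im ^ 2 ≤ 501 / 500 * η ^ 2) (hη0 : 0 ≤ η) (hη : η ≤ 1 / 14) (hfar : 3 * η < ‖ξ‖) :
    ‖ξ - 1‖ * ‖ξ + 1‖ ≤ Real.exp (-(43 / 200 * ‖ξ‖ ^ 2)) := by
  have h1 : ‖ξ‖ ^ 2 = ξ.re ^ 2 + ξ.im ^ 2 := by
    rw [← Complex.normSq_eq_norm_sq, Complex.normSq_apply]; ring
  have h2 : (‖ξ - 1‖ * ‖ξ + 1‖) ^ 2 =
      (1 - ξ.re ^ 2) ^ 2 + 2 * ξ.im ^ 2 * (1 + ξ.re ^ 2) + ξ.im ^ 2 * ξ.im ^ 2 := by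
    rw [mul_pow, ← Complex.normSq_eq_norm_sq, ← Complex.normSq_eq_norm_sq, Complex.normSq_apply,
      Complex.normSq_apply]
    simp
    ring
  have h3 : 9 * η ^ 2 < ‖ξ‖ ^ 2 := by nlinarith
  have hx1 : ξ.re ^ 2 ≤ 1 := (sq_le_one_iff_abs_le_one _).2 hre
  have hx0 := sq_nonneg ξ.re
  have hy0 := sq_nonneg ξ.im
  have h8 : η ^ 2 ≤ 1 / 196 := by nlinarith
  set X := ξ.re ^ 2
  set Y := ξ.im ^ 2
  have hY : Y ≤ 63 / 500 * X := by rw [h1] at h3; linarith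
  have hY2 : Y ≤ 13 / 2500 := by linarith
  have h4 : (‖ξ - 1‖ * ‖ξ + 1‖) ^ 2 ≤ 1 - 43 / 100 * (X + Y) := by
    rw [h2]
    have hXX : X * X ≤ X := by nlinarith
    have hYX : Y * X ≤ 63 / 500 * X := by nlinarith
    have hYY : Y * Y ≤ 13 / 2500 * Y := by nlinarith
    nlinarith
  have h5 : (‖ξ - 1‖ * ‖ξ + 1‖) ^ 2 ≤ Real.exp (-(43 / 200 * ‖ξ‖ ^ 2)) ^ 2 := by
    rw [← Real.exp_nat_mul]
    refine h4.trans (le_trans (le_of_eq ?_) (Real.add_one_le_exp _))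
    rw [h1]; push_cast; ring
  exact abs_le_of_sq_le_sq' h5 (Real.exp_pos _).le |>.2

/-- The derivative of `(ξ - 1) ^ (k + 1 + ε) * (ξ + 1) ^ (k + 1)` at a point of a thin neighbourhood
of `[-1, 1]`, compared with the value of the polynomial at the same point or with `1`. -/
lemma endpoint_polynomial_estimate {ξ : ℂ} {η : ℝ} {k ε n : ℕ} (hε : ε ≤ 1)
    (hn : n = 2 * k + 2 + ε) (hn2 : 784 < n) (hre : |ξ.re| ≤ 1) (hξ : ‖ξ - 1‖ ≤ 2)
    (him : ξ.im ^ 2 ≤ 501 / 500 * η ^ 2) (hη0 : 0 ≤ η) (hη : η ≤ 1 / 14) :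
    ‖ξ - 1‖ ^ (k + ε) * ‖ξ + 1‖ ^ k * ‖(n : ℂ) * ξ + ε‖ ≤
      max (7 * η * n) (14 * √n) * max 1 (‖ξ - 1‖ ^ (k + 1 + ε) * ‖ξ + 1‖ ^ (k + 1)) := by
  have hn' : (784 : ℝ) < n := by exact_mod_cast hn2
  have hsq : √(n : ℝ) ^ 2 = n := Real.sq_sqrt (Nat.cast_nonneg n)
  have hs28 : 28 ≤ √(n : ℝ) := by
    refine Real.le_sqrt_of_sq_le ?_
    linarith
  have hε' : (ε : ℝ) ≤ 1 := by exact_mod_cast hε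
  have hlin : ‖(n : ℂ) * ξ + ε‖ ≤ n * ‖ξ‖ + 1 := by
    refine (norm_add_le _ _).trans ?_
    rw [norm_mul, Complex.norm_natCast, Complex.norm_natCast]
    linarith
  set q := ‖ξ - 1‖ * ‖ξ + 1‖ with hq
  have hq0 : 0 ≤ q := by positivity
  set T := max (7 * η * n) (14 * √n) with hT
  have hT1 : 7 * η * n ≤ T := le_max_left _ _
  have hT2 : 14 * √n ≤ T := le_max_right _ _
  by_cases hnear : ‖ξ‖ ≤ 3 * η
  · -- Near the centre the logarithmic derivative is small.
    set g := ‖ξ - 1‖ ^ (k + 1 + ε) * ‖ξ + 1‖ ^ (k + 1) with hg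
    have hg0 : 0 ≤ g := by positivity
    have hqlow : 19 / 20 ≤ q := by
      have h1 : q = ‖ξ ^ 2 - 1‖ := by rw [hq, ← norm_mul]; congr 1; ring
      have h2 := norm_sub_norm_le (1 : ℂ) (ξ ^ 2)
      rw [norm_sub_rev, ← h1, norm_one, norm_pow] at h2
      have h3 : ‖ξ‖ ^ 2 ≤ (3 / 14) ^ 2 := by gcongr; linarith
      linarith
    have hmul : ‖ξ - 1‖ ^ (k + ε) * ‖ξ + 1‖ ^ k * ‖(n : ℂ) * ξ + ε‖ * q =
        g * ‖(n : ℂ) * ξ + ε‖ := by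
      rw [hq, hg]; ring
    have h1 : ‖(n : ℂ) * ξ + ε‖ ≤ T * q := by
      have h2 : (n : ℝ) * ‖ξ‖ ≤ n * (3 * η) := by gcongr
      have h3 : T * (19 / 20) ≤ T * q := by gcongr
      linarith
    have h2 : ‖ξ - 1‖ ^ (k + ε) * ‖ξ + 1‖ ^ k * ‖(n : ℂ) * ξ + ε‖ * q ≤ T * g * q := by
      rw [hmul]
      calc g * ‖(n : ℂ) * ξ + ε‖ ≤ g * (T * q) := by gcongr
        _ = T * g * q := by ring
    have hq1 : 0 < q := by linarith
    refine (le_of_mul_le_mul_right h2 hq1).trans ?_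
    have : 0 ≤ T := by linarith
    gcongr
    exact le_max_right _ _
  · push Not at hnear
    have hqexp := norm_sub_one_mul_norm_add_one_le hre him hη0 hη hnear
    rw [← hq] at hqexp
    have hpow : q ^ k ≤ 1 / (1 + 1 / 10 * n * ‖ξ‖ ^ 2) := by
      calc q ^ k ≤ Real.exp (-(43 / 200 * ‖ξ‖ ^ 2)) ^ k := by gcongr
        _ = Real.exp (-(k * (43 / 200 * ‖ξ‖ ^ 2))) := by rw [← Real.exp_nat_mul]; ring_nf
        _ ≤ Real.exp (-(1 / 10 * n * ‖ξ‖ ^ 2)) := by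
            refine Real.exp_le_exp.2 (neg_le_neg ?_)
            have h1 : (n : ℝ) = 2 * k + 2 + ε := by exact_mod_cast hn
            have h2 : (1 / 10 : ℝ) * n ≤ k * (43 / 200) := by linarith
            calc 1 / 10 * n * ‖ξ‖ ^ 2 ≤ k * (43 / 200) * ‖ξ‖ ^ 2 := by gcongr
              _ = _ := by ring
        _ ≤ 1 / (1 + 1 / 10 * n * ‖ξ‖ ^ 2) := by
            rw [Real.exp_neg, ← one_div]
            refine one_div_le_one_div_of_le (by positivity) ?_
            linarith [Real.add_one_le_exp (1 / 10 * n * ‖ξ‖ ^ 2)]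
    have hε2 : ‖ξ - 1‖ ^ ε ≤ 2 := by
      interval_cases ε <;> simp [hξ]
    have h1 : ‖ξ - 1‖ ^ (k + ε) * ‖ξ + 1‖ ^ k * ‖(n : ℂ) * ξ + ε‖ ≤
        2 * (1 / (1 + 1 / 10 * n * ‖ξ‖ ^ 2)) * (n * ‖ξ‖ + 1) := by
      have h2 : ‖ξ - 1‖ ^ (k + ε) * ‖ξ + 1‖ ^ k = ‖ξ - 1‖ ^ ε * q ^ k := by
        rw [hq, mul_pow]; ring
      rw [h2]
      gcongr
    have h3 : 2 * (1 / (1 + 1 / 10 * n * ‖ξ‖ ^ 2)) * (n * ‖ξ‖ + 1) ≤ 14 * √n := by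
      rw [mul_one_div, div_mul_eq_mul_div, div_le_iff₀ (by positivity)]
      set r := √(n : ℝ)
      rw [← hsq]
      have h4 : r * ‖ξ‖ ≤ 63 / 100 * (r * ‖ξ‖) ^ 2 + 6 := by
        nlinarith [sq_nonneg (r * ‖ξ‖ - 1)]
      have h5 : r * (r * ‖ξ‖) ≤ r * (63 / 100 * (r * ‖ξ‖) ^ 2 + 6) := by gcongr
      nlinarith [mul_nonneg (by linarith : (0 : ℝ) ≤ r) (sq_nonneg (r * ‖ξ‖))]
    calc _ ≤ 14 * √n := h1.trans h3
      _ ≤ T * 1 := by linarith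
      _ ≤ _ := by
        have : 0 ≤ T := by linarith
        gcongr
        exact le_max_left _ _

lemma inverseMarkovFactor_le {K : Set ℂ} {n : ℕ} {P : Polynomial ℂ} (hP : P ∈ polysWithZerosIn n K)
    {R C : ℝ} (hC : 0 < C) (h1 : supNormOn K P.derivative ≤ R * C) (h2 : C ≤ supNormOn K P) :
    inverseMarkovFactor n K ≤ R := by
  have hR : 0 ≤ R := by
    by_contra! h
    have := supNormOn_nonneg K P.derivative
    nlinarith
  refine (csInf_le ?_ (Set.mem_image_of_mem _ hP)).trans ?_
  · refine ⟨0, ?_⟩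
    rintro _ ⟨Q, _, rfl⟩
    exact div_nonneg (supNormOn_nonneg _ _) (supNormOn_nonneg _ _)
  · rw [div_le_iff₀ (hC.trans_le h2)]
    exact h1.trans (by gcongr)

/-- The power `(X - x) ^ n` for an end point `x` of a diameter. -/
lemma inverseMarkovFactor_le_div_diam {K : Set ℂ} (hK : IsCompact K) (hnt : K.Nontrivial) (n : ℕ)
    (hn : 1 ≤ n) : inverseMarkovFactor n K ≤ n / Metric.diam K := by
  have hd0 : 0 < Metric.diam K := Metric.diam_pos hnt hK.isBounded
  obtain ⟨x, hx, y, hy, hxy⟩ := exists_dist_eq_diam hK hnt.nonempty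
  refine inverseMarkovFactor_le (X_sub_C_pow_mem_polysWithZerosIn hx n)
    (C := Metric.diam K ^ n) (by positivity) (supNormOn_le hnt.nonempty _ fun z hz => ?_) ?_
  · have h1 : ‖z - x‖ ≤ Metric.diam K := by
      rw [← dist_eq_norm]; exact Metric.dist_le_diam_of_mem hK.isBounded hz hx
    obtain ⟨m, rfl⟩ : ∃ m, n = m + 1 := ⟨n - 1, by omega⟩
    rw [Polynomial.derivative_X_sub_C_pow]
    simp only [Polynomial.eval_mul, Polynomial.eval_pow, Polynomial.eval_sub, Polynomial.eval_X,
      Polynomial.eval_C, norm_mul, norm_pow, Complex.norm_natCast, Nat.add_sub_cancel]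
    calc ((m + 1 : ℕ) : ℝ) * ‖z - x‖ ^ m ≤ ((m + 1 : ℕ) : ℝ) * Metric.diam K ^ m := by gcongr
      _ = _ := by field_simp; ring
  · refine le_trans (le_of_eq ?_) (norm_eval_le_supNormOn hK _ hy)
    rw [← hxy, dist_comm, dist_eq_norm]
    simp

/-- The upper bound with the width replaced by the thickness `δ` of any strip containing `K`, for
thin strips and large degrees: the zeros are placed at the two end points of a diameter. -/
lemma inverseMarkovFactor_le_of_thin {K : Set ℂ} (hK : IsCompact K) (hconn : IsConnected K)
    (hnt : K.Nontrivial) {n : ℕ} (hn : 784 < n) {δ a : ℝ} {u : ℂ} (hδ : 0 ≤ δ) (hu : ‖u‖ = 1)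
    (hstrip : ∀ z ∈ K, a ≤ inner ℝ u z ∧ inner ℝ u z ≤ a + δ) (hthin : δ < Metric.diam K / 28) :
    inverseMarkovFactor n K ≤ 28 * max (δ * n / Metric.diam K ^ 2) (√n / Metric.diam K) := by
  obtain ⟨x, hx, y, hy, hxy⟩ := exists_dist_eq_diam hK hnt.nonempty
  set d := Metric.diam K with hd
  have hd0 : 0 < d := Metric.diam_pos hnt hK.isBounded
  obtain ⟨k, ε, hε, hnk⟩ : ∃ k ε : ℕ, ε ≤ 1 ∧ n = 2 * k + 2 + ε :=
    ⟨n / 2 - 1, n % 2, by omega, by omega⟩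
  -- The affine coordinate `ξ` in which `x` and `y` become `-1` and `1`.
  set v : ℂ := (y - x) / 2 with hv
  set ξ : ℂ → ℂ := fun z => (z - (x + y) / 2) / v with hξ
  have hvn : ‖v‖ = d / 2 := by
    rw [hv, norm_div, ← dist_eq_norm, dist_comm, hxy]; simp
  have hv0 : v ≠ 0 := norm_pos_iff.1 (by rw [hvn]; positivity)
  have hzx : ∀ z, z - x = v * (ξ z + 1) := by
    intro z; rw [hξ]; field_simp; rw [hv]; ring
  have hzy : ∀ z, z - y = v * (ξ z - 1) := by
    intro z; rw [hξ]; field_simp; rw [hv]; ring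
  have hξx : ξ x = -1 := by
    have := hzx x
    rw [sub_self, eq_comm, mul_eq_zero] at this
    exact eq_neg_of_add_eq_zero_left (this.resolve_left hv0)
  have hξy : ξ y = 1 := by
    have := hzy y
    rw [sub_self, eq_comm, mul_eq_zero] at this
    exact sub_eq_zero.1 (this.resolve_left hv0)
  have hxi1 : ∀ z ∈ K, ‖ξ z - 1‖ ≤ 2 := by
    intro z hz
    have h1 := Metric.dist_le_diam_of_mem hK.isBounded hz hy
    rw [dist_eq_norm, hzy, norm_mul, hvn] at h1
    by_contra! h
    nlinarith
  have hxi2 : ∀ z ∈ K, ‖ξ z + 1‖ ≤ 2 := by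
    intro z hz
    have h1 := Metric.dist_le_diam_of_mem hK.isBounded hz hx
    rw [dist_eq_norm, hzx, norm_mul, hvn] at h1
    by_contra! h
    nlinarith
  have hre : ∀ z ∈ K, |(ξ z).re| ≤ 1 := by
    intro z hz
    have h1 := (abs_le.1 ((Complex.abs_re_le_norm _).trans (hxi1 z hz))).1
    have h2 := (abs_le.1 ((Complex.abs_re_le_norm _).trans (hxi2 z hz))).2
    simp at h1 h2
    exact abs_le.2 ⟨by linarith, by linarith⟩
  set η := 2 * δ / d with hη
  have hη0 : 0 ≤ η := by positivity
  have hη1 : η ≤ 1 / 14 := by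
    rw [hη, div_le_iff₀ hd0]; linarith
  have hδη : δ = d / 2 * η := by rw [hη]; field_simp
  -- The rotated unit normal `c` of the strip is almost vertical.
  have him : ∀ z ∈ K, (ξ z).im ^ 2 ≤ 501 / 500 * η ^ 2 := by
    intro z hz
    set c : ℂ := (starRingEnd ℂ) u * v / (d / 2 : ℝ) with hc
    have hc1 : c.re ^ 2 + c.im ^ 2 = 1 := by
      have h1 : ‖c‖ = 1 := by
        rw [hc, norm_div, norm_mul, RCLike.norm_conj, hu, hvn, Complex.norm_real, Real.norm_eq_abs,
          abs_of_pos (by positivity), one_mul, div_self (by positivity)]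
      have h2 : ‖c‖ ^ 2 = c.re ^ 2 + c.im ^ 2 := by
        rw [← Complex.normSq_eq_norm_sq, Complex.normSq_apply]; ring
      rw [← h2, h1, one_pow]
    have hinner : ∀ p q : ℂ, inner ℝ u p - inner ℝ u q =
        d / 2 * (c.re * ((ξ p).re - (ξ q).re) - c.im * ((ξ p).im - (ξ q).im)) := by
      intro p q
      have h1 : p - q = v * (ξ p - ξ q) := by
        linear_combination hzx p - hzx q
      have h2 : (starRingEnd ℂ) u * (p - q) = (d / 2 : ℝ) * (c * (ξ p - ξ q)) := by
        have : ((d / 2 : ℝ) : ℂ) ≠ 0 := by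
          have : (d / 2 : ℝ) ≠ 0 := by positivity
          exact_mod_cast this
        rw [h1, hc]
        field_simp
      rw [← inner_sub_right, Complex.inner, mul_comm, h2, Complex.re_ofReal_mul, Complex.mul_re,
        Complex.sub_re, Complex.sub_im]
    have hbd : ∀ p ∈ K, ∀ q ∈ K,
        c.re * ((ξ p).re - (ξ q).re) - c.im * ((ξ p).im - (ξ q).im) ≤ η := by
      intro p hp q hq
      have h1 := hinner p q
      have h2 := (hstrip p hp).2
      have h3 := (hstrip q hq).1
      refine le_of_mul_le_mul_left (a := d / 2) ?_ (by positivity)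
      rw [← h1, ← hδη]
      linarith
    have e1 := hbd x hx y hy
    have e2 := hbd y hy x hx
    have e3 := hbd z hz x hx
    have e4 := hbd z hz y hy
    have e5 := hbd x hx z hz
    have e6 := hbd y hy z hz
    rw [hξx] at e1 e2 e3 e5
    rw [hξy] at e1 e2 e4 e6
    simp at e1 e2 e3 e4 e5 e6
    obtain ⟨hr1, hr2⟩ := abs_le.1 (hre z hz)
    have hcre : c.re ^ 2 ≤ 1 / 784 := by
      have : c.re ^ 2 ≤ (1 / 28) ^ 2 := sq_le_sq' (by linarith) (by linarith)
      norm_num at this ⊢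
      exact this
    have hprod : |c.im * (ξ z).im| ≤ η := by
      rcases le_total 0 c.re with h | h
      · exact abs_le.2 ⟨by nlinarith, by nlinarith⟩
      · exact abs_le.2 ⟨by nlinarith, by nlinarith⟩
    have hsq : c.im ^ 2 * (ξ z).im ^ 2 ≤ η ^ 2 := by
      rw [← mul_pow]; exact sq_le_sq' (abs_le.1 hprod).1 (abs_le.1 hprod).2
    have hcim : 783 / 784 ≤ c.im ^ 2 := by linarith
    have := mul_le_mul_of_nonneg_right hcim (sq_nonneg (ξ z).im)
    nlinarith [sq_nonneg η]
  set P : Polynomial ℂ := (Polynomial.X - Polynomial.C y) ^ (k + 1 + ε) *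
    (Polynomial.X - Polynomial.C x) ^ (k + 1) with hP
  have hPmem : P ∈ polysWithZerosIn n K := by
    refine ⟨?_, fun z hz => ?_⟩
    · rw [hP, Polynomial.degree_mul, Polynomial.degree_pow, Polynomial.degree_pow,
        Polynomial.degree_X_sub_C, Polynomial.degree_X_sub_C, hnk]
      simp only [nsmul_eq_mul, mul_one]
      norm_cast
      ring
    · have h : (z - y) ^ (k + 1 + ε) * (z - x) ^ (k + 1) = 0 := by
        simpa [hP, Polynomial.IsRoot.def] using hz
      rcases mul_eq_zero.1 h with h | h
      · rwa [sub_eq_zero.1 ((pow_eq_zero_iff (by omega)).1 h)]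
      · rwa [sub_eq_zero.1 ((pow_eq_zero_iff (by omega)).1 h)]
  have hPn : ∀ z, ‖P.eval z‖ =
      ‖v‖ ^ n * (‖ξ z - 1‖ ^ (k + 1 + ε) * ‖ξ z + 1‖ ^ (k + 1)) := by
    intro z
    have h : P.eval z = (z - y) ^ (k + 1 + ε) * (z - x) ^ (k + 1) := by simp [hP]
    rw [h, hzx, hzy, hnk]
    simp only [norm_mul, norm_pow]
    ring
  have hP'n : ∀ z, ‖P.derivative.eval z‖ =
      ‖v‖ ^ (n - 1) * (‖ξ z - 1‖ ^ (k + ε) * ‖ξ z + 1‖ ^ k * ‖(n : ℂ) * ξ z + ε‖) := by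
    intro z
    have h : P.derivative.eval z = (z - y) ^ (k + ε) * (z - x) ^ k *
        ((k + 1 + ε) * (z - x) + (k + 1) * (z - y)) := by
      rw [hP, Polynomial.derivative_mul, Polynomial.derivative_X_sub_C_pow,
        Polynomial.derivative_X_sub_C_pow, show k + 1 + ε - 1 = k + ε by omega, Nat.add_sub_cancel]
      simp
      ring
    have h2 : ((k : ℂ) + 1 + ε) * (z - x) + (k + 1) * (z - y) = v * ((n : ℂ) * ξ z + ε) := by
      rw [hzx, hzy, hnk]; push_cast; ring
    rw [h, h2, hzx, hzy, show n - 1 = k + ε + k + 1 by omega]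
    simp only [norm_mul, norm_pow]
    ring
  -- By connectedness `K` meets the perpendicular bisector of the diameter.
  obtain ⟨z₀, hz₀, hz₀re⟩ : ∃ z ∈ K, (ξ z).re = 0 := by
    have hcont : ContinuousOn (fun z => (ξ z).re) K := by
      have : Continuous ξ := by rw [hξ]; fun_prop
      exact (Complex.continuous_re.comp this).continuousOn
    have h := hconn.isPreconnected.intermediate_value hx hy hcont
    obtain ⟨z, hz, hz0⟩ := h (show (0 : ℝ) ∈ Set.Icc _ _ by
      rw [hξx, hξy]; constructor <;> norm_num)
    exact ⟨z, hz, hz0⟩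
  have hone : 1 ≤ ‖ξ z₀ - 1‖ ^ (k + 1 + ε) * ‖ξ z₀ + 1‖ ^ (k + 1) := by
    have h1 := Complex.abs_re_le_norm (ξ z₀ - 1)
    have h2 := Complex.abs_re_le_norm (ξ z₀ + 1)
    simp [hz₀re] at h1 h2
    exact one_le_mul_of_one_le_of_one_le (one_le_pow₀ h1) (one_le_pow₀ h2)
  have hvpos : 0 < ‖v‖ := norm_pos_iff.2 hv0
  have hCpos : 0 < supNormOn K P := by
    refine lt_of_lt_of_le ?_ (norm_eval_le_supNormOn hK P hz₀)
    rw [hPn]; positivity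
  refine inverseMarkovFactor_le hPmem hCpos (supNormOn_le hnt.nonempty _ fun z hz => ?_) le_rfl
  have hmain := endpoint_polynomial_estimate hε hnk hn (hre z hz) (hxi1 z hz) (him z hz) hη0 hη1
  have hmax : ‖v‖ ^ n * max 1 (‖ξ z - 1‖ ^ (k + 1 + ε) * ‖ξ z + 1‖ ^ (k + 1)) ≤
      supNormOn K P := by
    rw [mul_max_of_nonneg _ _ (by positivity)]
    refine max_le ?_ ?_
    · refine le_trans ?_ (norm_eval_le_supNormOn hK P hz₀)
      rw [hPn]
      gcongr
    · rw [← hPn]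
      exact norm_eval_le_supNormOn hK P hz
  have hT : 28 * max (δ * n / d ^ 2) (√n / d) * ‖v‖ = max (7 * η * n) (14 * √n) := by
    rw [mul_max_of_nonneg _ _ (by norm_num), max_mul_of_nonneg _ _ hvpos.le, hvn, hη]
    congr 1
    · field_simp; ring
    · field_simp; norm_num
  have hnn : ‖v‖ ^ n = ‖v‖ * ‖v‖ ^ (n - 1) := by
    rw [← pow_succ', Nat.sub_add_cancel (by omega)]
  have hR : 0 ≤ 28 * max (δ * n / d ^ 2) (√n / d) := by positivity
  calc ‖P.derivative.eval z‖ ≤ ‖v‖ ^ (n - 1) * (max (7 * η * n) (14 * √n) *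
        max 1 (‖ξ z - 1‖ ^ (k + 1 + ε) * ‖ξ z + 1‖ ^ (k + 1))) := by
        rw [hP'n]; gcongr
    _ = 28 * max (δ * n / d ^ 2) (√n / d) *
        (‖v‖ ^ n * max 1 (‖ξ z - 1‖ ^ (k + 1 + ε) * ‖ξ z + 1‖ ^ (k + 1))) := by
        rw [← hT, hnn]; ring
    _ ≤ _ := by gcongr

theorem inverseMarkovFactor_le_max {K : Set ℂ} (hK : IsCompact K) (hconn : IsConnected K)
    (hnt : K.Nontrivial) {n : ℕ} (hn : 1 ≤ n) :
    inverseMarkovFactor n K ≤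
      28 * max (minWidth K * n / Metric.diam K ^ 2) (√n / Metric.diam K) := by
  have hd0 : 0 < Metric.diam K := Metric.diam_pos hnt hK.isBounded
  have hn0 : (0 : ℝ) < n := by exact_mod_cast hn
  have hstep : ∀ δ : ℝ, (0 ≤ δ ∧ ∃ u : ℂ, ‖u‖ = 1 ∧ ∃ a : ℝ, ∀ z ∈ K,
      a ≤ inner ℝ u z ∧ inner ℝ u z ≤ a + δ) →
      inverseMarkovFactor n K ≤ 28 * max (δ * n / Metric.diam K ^ 2) (√n / Metric.diam K) := by
    rintro δ ⟨hδ, u, hu, a, hstrip⟩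
    have htriv := inverseMarkovFactor_le_div_diam hK hnt n hn
    by_cases hthin : δ < Metric.diam K / 28
    · by_cases hbig : 784 < n
      · exact inverseMarkovFactor_le_of_thin hK hconn hnt hbig hδ hu hstrip hthin
      · refine htriv.trans (le_trans ?_ (mul_le_mul_of_nonneg_left (le_max_right _ _) (by norm_num)))
        rw [← mul_div_assoc]
        gcongr
        have h1 : √(n : ℝ) ≤ 28 := by
          rw [Real.sqrt_le_left (by norm_num)]
          norm_num
          exact_mod_cast not_lt.1 hbig
        nlinarith [Real.mul_self_sqrt hn0.le, Real.sqrt_nonneg (n : ℝ)]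
    · refine htriv.trans (le_trans ?_ (mul_le_mul_of_nonneg_left (le_max_left _ _) (by norm_num)))
      rw [← mul_div_assoc, div_le_div_iff₀ hd0 (by positivity)]
      have h1 : Metric.diam K ≤ 28 * δ := by linarith [not_lt.1 hthin]
      have h2 : Metric.diam K * (n * Metric.diam K) ≤ 28 * δ * (n * Metric.diam K) := by gcongr
      linarith
  by_cases hs : inverseMarkovFactor n K ≤ 28 * (√n / Metric.diam K)
  · exact hs.trans (mul_le_mul_of_nonneg_left (le_max_right _ _) (by norm_num))
  push Not at hs
  -- Every admissible thickness `δ` satisfies the bound, hence so does their infimum.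
  have hne : {δ : ℝ | 0 ≤ δ ∧ ∃ u : ℂ, ‖u‖ = 1 ∧ ∃ a : ℝ, ∀ z ∈ K,
      a ≤ inner ℝ u z ∧ inner ℝ u z ≤ a + δ}.Nonempty := by
    obtain ⟨C, hC⟩ := hK.isBounded.exists_norm_le
    refine ⟨2 * |C|, by positivity, 1, norm_one, -|C|, fun z hz => ?_⟩
    have h1 : |inner ℝ (1 : ℂ) z| ≤ |C| := by
      refine (abs_real_inner_le_norm _ _).trans ?_
      rw [norm_one, one_mul]
      exact (hC z hz).trans (le_abs_self C)
    rw [abs_le] at h1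
    exact ⟨h1.1, by linarith [h1.2]⟩
  have hw : inverseMarkovFactor n K * Metric.diam K ^ 2 / (28 * n) ≤ minWidth K := by
    refine le_csInf hne fun δ hδ => ?_
    have h1 := hstep δ hδ
    rw [mul_max_of_nonneg _ _ (by norm_num)] at h1
    have h2 := (le_max_iff.1 h1).resolve_right (not_le.2 hs)
    rw [← mul_div_assoc, le_div_iff₀ (by positivity)] at h2
    rw [div_le_iff₀ (by positivity)]
    linarith
  refine le_trans ?_ (mul_le_mul_of_nonneg_left (le_max_left _ _) (by norm_num))
  rw [div_le_iff₀ (by positivity)] at hw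
  rw [← mul_div_assoc, le_div_iff₀ (by positivity)]
  linarith

theorem theorem1 :
    ∃ c₁ c₂ : ℝ, 0 < c₁ ∧ 0 < c₂ ∧ c₂ = 28 ∧
      (∀ K : Set ℂ, IsCompact K → Convex ℝ K → K.Nontrivial → ∀ n : ℕ, 1 ≤ n →
        c₁ * max (minWidth K * n / Metric.diam K ^ 2) (√n / Metric.diam K)
            ≤ inverseMarkovFactor n K ∧
        inverseMarkovFactor n K
            ≤ c₂ * max (minWidth K * n / Metric.diam K ^ 2) (√n / Metric.diam K)) ∧
      (∀ K : Set ℂ, IsCompact K → IsConnected K → K.Nontrivial → ∀ n : ℕ, 1 ≤ n →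
        inverseMarkovFactor n K
            ≤ c₂ * max (minWidth K * n / Metric.diam K ^ 2) (√n / Metric.diam K)) :=
  ⟨1 / 8000000, 28, by norm_num, by norm_num, rfl,
    fun _ hK hconv hnt _ hn => ⟨le_inverseMarkovFactor hK hconv hnt hn,
      inverseMarkovFactor_le_max hK (hconv.isConnected hnt.nonempty) hnt hn⟩,
    fun _ hK hconn hnt _ hn => inverseMarkovFactor_le_max hK hconn hnt hn⟩
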